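/- Let $G$ be a connected (finite-dimensional, real) Lie group with Lie algebra $\mathfrak g$ and let $H\subset G$ be a connected closed subgroup with Lie algebra $\mathfrak h$. Equip $G/H$ with the quotient manifold structure (the one for which the projection $p:G\to G/H$ is a smooth submersion) and write $\bar e=H\in G/H$. The tangent map $T_ep:\mathfrak g\to T_{\bar e}(G/H)$ has kernel $\mathfrak h$ and identifies $\mathfrak g/\mathfrak h$ with $T_{\bar e}(G/H)$; under this identification it is the canonical projection $q:\mathfrak g\to\mathfrak g/\mathfrak h$. A Poisson tensor on $G/H$ is a smooth skew-symmetric bivector field $\pi$ with vanishing Schouten–Nijenhuis bracket $[\pi,\pi]_S=0$; it is $G$-invariant if $\pi(\lambda_g^*\alpha,\lambda_g^*\beta)=\pi(\alpha,\beta)\circ\lambda_g$ for all $g\in G$ and all one-forms $\alpha,\beta$, where $\lambda_g(aH)=gaH$. For such $\pi$ let $r\in\wedge^2(\mathfrak g/\mathfrak h)$ be the value of $\pi$ at $\bar e$, and let $r_\#:(\mathfrak g/\mathfrak h)^*\to\mathfrak g/\mathfrak h$, $\alpha\mapsto\alpha^\#$, be given by $\langle\beta,\alpha^\#\rangle=r(\alpha,\beta)$.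 Then $\mathfrak a_r:=q^{-1}(\operatorname{Im} r_\#)$ is a Lie subalgebra of $\mathfrak g$ containing $\mathfrak h$; the formula $\omega_r(x,y):=r(\alpha,\beta)$, where $\alpha,\beta\in(\mathfrak g/\mathfrak h)^*$ are any elements with $q(x)=\alpha^\#$ and $q(y)=\beta^\#$, gives a well-defined skew-symmetric bilinear form on $\mathfrak a_r$; and $$\pi\longmapsto(\mathfrak a_r,\omega_r)$$ is a bijection from the set of $G$-invariant Poisson tensors on $G/H$ onto the set of pairs $(\mathfrak a,\omega)$ in which $\mathfrak a$ is a Lie subalgebra of $\mathfrak g$ with $\mathfrak h\subset\mathfrak a$ and $\omega$ is a 2-cocycle on $\mathfrak a$ (a skew-symmetric bilinear form $\omega:\mathfrak a\times\mathfrak a\to\mathbb R$ with $\omega([x,y],z)+\omega([y,z],x)+\omega([z,x],y)=0$ for all $x,y,z\in\mathfrak a$) such that $\operatorname{Rad}(\omega)=\{x\in\mathfrak a\mid\omega(x,y)=0\ \text{for all}\ y\in\mathfrak a\}=\mathfrak h$. -/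

import Mathlib

open scoped Manifold ContDiff

noncomputable section

namespace HomPoisson

instance : ENat.LEInfty (minSmoothness ℝ 3) :=
  ⟨by rw [minSmoothness_of_isRCLikeNormedField]; exact ENat.LEInfty.out⟩

/-! ### Bivector fields on a manifold -/

section Bivector

/-- The cotangent space `T*ₓM` of a manifold `M` modelled on the finite-dimensional space `F`. -/
abbrev Cotangent (F : Type*) [NormedAddCommGroup F] [NormedSpace ℝ F]
    {M : Type*} [TopologicalSpace M] [ChartedSpace F M] (x : M) : Type _ :=
  Module.Dual ℝ (TangentSpace 𝓘(ℝ, F) x)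

/-- A field of contravariant 2-tensors on `M`: at each point `x` a bilinear form on `T*ₓM`. -/
abbrev ContraTensorField (F : Type*) [NormedAddCommGroup F] [NormedSpace ℝ F]
    (M : Type*) [TopologicalSpace M] [ChartedSpace F M] : Type _ :=
  (x : M) → LinearMap.BilinForm ℝ (Cotangent F x)

/-- The differential `d_x f ∈ T*ₓM` of a real function at a point `x`. -/
def differential (F : Type*) [NormedAddCommGroup F] [NormedSpace ℝ F]
    {M : Type*} [TopologicalSpace M] [ChartedSpace F M] (f : M → ℝ) (x : M) : Cotangent F x :=
  (mvfderiv 𝓘(ℝ, F) f x).toLinearMap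

/-- The pullback `φ*α = α ∘ T_x φ ∈ T*ₓM` of a covector `α ∈ T*_{φ x}M` under `φ : M → M`. -/
def pullback {F : Type*} [NormedAddCommGroup F] [NormedSpace ℝ F]
    {M : Type*} [TopologicalSpace M] [ChartedSpace F M] (φ : M → M) (x : M)
    (α : Cotangent F (φ x)) : Cotangent F x :=
  α ∘ₗ (mfderiv 𝓘(ℝ, F) 𝓘(ℝ, F) φ x).toLinearMap

/-- The bracket of functions `{f, g} = π(df, dg)`. -/
def fnBracket {F : Type*} [NormedAddCommGroup F] [NormedSpace ℝ F]
    {M : Type*} [TopologicalSpace M] [ChartedSpace F M] (π : ContraTensorField F M)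
    (f g : M → ℝ) : M → ℝ :=
  fun x => π x (differential F f x) (differential F g x)

/-- Smoothness of a contravariant 2-tensor field: `π(df, dg)` is smooth on `U` for all smooth
functions `f, g` on an open set `U`. (In a chart, with `f, g` coordinate functions, this says that
the components `π^{ij}` are smooth, and conversely.) -/
def IsSmoothTensor {F : Type*} [NormedAddCommGroup F] [NormedSpace ℝ F]
    {M : Type*} [TopologicalSpace M] [ChartedSpace F M] (π : ContraTensorField F M) : Prop :=
  ∀ (U : Set M) (f g : M → ℝ), IsOpen U →
    ContMDiffOn 𝓘(ℝ, F) 𝓘(ℝ, ℝ) ∞ f U → ContMDiffOn 𝓘(ℝ, F) 𝓘(ℝ, ℝ) ∞ g U →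
      ContMDiffOn 𝓘(ℝ, F) 𝓘(ℝ, ℝ) ∞ (fnBracket π f g) U

/-- The local function `y ↦ α(chart_x y)` near `x`, linear in the preferred chart at `x`, whose
differential at `x` is the covector `α ∈ T*ₓM` (in Mathlib `TangentSpace 𝓘(ℝ, F) x` is the model
space `F`, the identification being given by the preferred chart at `x`). -/
def linCoord {F : Type*} [NormedAddCommGroup F] [NormedSpace ℝ F]
    {M : Type*} [TopologicalSpace M] [ChartedSpace F M] (x : M) (α : Cotangent F x) : M → ℝ :=
  fun y => (show Module.Dual ℝ F from α) (extChartAt 𝓘(ℝ, F) x y)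

/-- The value at `x` of the Schouten-Nijenhuis bracket `[π, π]_S` of a bivector field with itself,
evaluated on `α, β, γ ∈ T*ₓM`. With coordinates `xⁱ` of the preferred chart at `x`, its components
are `[π, π]^{ijk} = 2 ∑ₗ (π^{lk} ∂ₗ π^{ij} + π^{li} ∂ₗ π^{jk} + π^{lj} ∂ₗ π^{ki})`; note that
`∑ₗ π^{lk} ∂ₗ π^{ij} = {π(dxⁱ, dxʲ), xᵏ} = {{xⁱ, xʲ}, xᵏ}`. -/
def schoutenSq {F : Type*} [NormedAddCommGroup F] [NormedSpace ℝ F]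
    {M : Type*} [TopologicalSpace M] [ChartedSpace F M] (π : ContraTensorField F M)
    (x : M) (α β γ : Cotangent F x) : ℝ :=
  2 * (fnBracket π (fnBracket π (linCoord x α) (linCoord x β)) (linCoord x γ) x
    + fnBracket π (fnBracket π (linCoord x β) (linCoord x γ)) (linCoord x α) x
    + fnBracket π (fnBracket π (linCoord x γ) (linCoord x α)) (linCoord x β) x)

/-- A Poisson tensor on `M`: a smooth skew-symmetric bivector field `π` with `[π, π]_S = 0`. -/
structure IsPoissonTensor {F : Type*} [NormedAddCommGroup F] [NormedSpace ℝ F]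
    {M : Type*} [TopologicalSpace M] [ChartedSpace F M] (π : ContraTensorField F M) : Prop where
  alt : ∀ x, (π x).IsAlt
  smooth : IsSmoothTensor π
  schouten : ∀ (x : M) (α β γ : Cotangent F x), schoutenSq π x α β γ = 0

/-- `π` is invariant under the action `λ_g : M → M` of `G`:
`π(λ_g^* α, λ_g^* β) = π(α, β) ∘ λ_g` for all `g`, `α`, `β`. -/
def IsInvariantTensor (G : Type*) [Group G] {F : Type*} [NormedAddCommGroup F] [NormedSpace ℝ F]
    {M : Type*} [TopologicalSpace M] [ChartedSpace F M] [MulAction G M]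
    (π : ContraTensorField F M) : Prop :=
  ∀ (g : G) (x : M) (α β : Cotangent F (g • x)),
    π x (pullback (fun y => g • y) x α) (pullback (fun y => g • y) x β) = π (g • x) α β

/-- The `G`-invariant Poisson tensors on `M`. -/
structure InvariantPoissonTensor (G : Type*) [Group G]
    (F : Type*) [NormedAddCommGroup F] [NormedSpace ℝ F]
    (M : Type*) [TopologicalSpace M] [ChartedSpace F M] [MulAction G M] where
  tensor : ContraTensorField F M
  poisson : IsPoissonTensor tensor
  invariant : IsInvariantTensor G tensor

instance {F : Type*} [NormedAddCommGroup F] [NormedSpace ℝ F] [h : FiniteDimensional ℝ F]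
    {M : Type*} [TopologicalSpace M] [ChartedSpace F M] (x : M) :
    FiniteDimensional ℝ (TangentSpace 𝓘(ℝ, F) x) := h

/-- The map `π_# : T*ₓM → TₓM`, `α ↦ α^#`, where `⟨β, α^#⟩ = π(α, β)` (see `apply_sharp`). -/
def sharp {F : Type*} [NormedAddCommGroup F] [NormedSpace ℝ F] [FiniteDimensional ℝ F]
    {M : Type*} [TopologicalSpace M] [ChartedSpace F M] (π : ContraTensorField F M) (x : M) :
    Cotangent F x →ₗ[ℝ] TangentSpace 𝓘(ℝ, F) x :=
  (Module.evalEquiv ℝ (TangentSpace 𝓘(ℝ, F) x)).symm.toLinearMap ∘ₗ π x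

theorem apply_sharp {F : Type*} [NormedAddCommGroup F] [NormedSpace ℝ F] [FiniteDimensional ℝ F]
    {M : Type*} [TopologicalSpace M] [ChartedSpace F M] (π : ContraTensorField F M) (x : M)
    (α β : Cotangent F x) : β (sharp π x α) = π x α β := by
  simp [sharp]

end Bivector

/-! ### Lie algebras -/

section Lie

/-- The Lie algebra `𝔥 = T_e H` of a closed subgroup `H` of the Lie group `G`, as a subset of the
Lie algebra `𝔤 = T_e G`: all velocities at time `0` of smooth curves of `G` that start at the
identity and stay in `H`. -/
def lieAlgOf {E : Type*} [NormedAddCommGroup E] [NormedSpace ℝ E]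
    {G : Type*} [TopologicalSpace G] [ChartedSpace E G] [Group G] (H : Subgroup G) :
    Set (GroupLieAlgebra 𝓘(ℝ, E) G) :=
  {X | ∃ γ : ℝ → G, ContMDiff 𝓘(ℝ, ℝ) 𝓘(ℝ, E) ∞ γ ∧ (∀ t, γ t ∈ H) ∧ γ 0 = 1 ∧
    HasMFDerivAt 𝓘(ℝ, ℝ) 𝓘(ℝ, E) γ 0 ((1 : ℝ →L[ℝ] ℝ).smulRight X)}

/-- The pairs `(𝔞, ω)` of a Lie subalgebra `𝔞` of `𝔤` containing `𝔥` and a 2-cocycle `ω` on `𝔞`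
(a skew-symmetric bilinear form with the cocycle identity) such that
`Rad(ω) = {x ∈ 𝔞 | ω(x, ·) = 0} = 𝔥`. -/
structure CocyclePair {L : Type*} [LieRing L] [LieAlgebra ℝ L] (𝔥 : Set L) where
  subalg : LieSubalgebra ℝ L
  le : 𝔥 ⊆ subalg
  form : LinearMap.BilinForm ℝ subalg
  alt : form.IsAlt
  cocycle : ∀ x y z : subalg, form ⁅x, y⁆ z + form ⁅y, z⁆ x + form ⁅z, x⁆ y = 0
  rad : ∀ x : subalg, (∀ y : subalg, form x y = 0) ↔ (x : L) ∈ 𝔥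

/-- The tangent map `T_e p : 𝔤 → T_ē(G/H)` of the projection `p : G → G/H`. For the quotient
manifold it is onto with kernel `𝔥`, and it is the projection `q : 𝔤 → 𝔤/𝔥` under the usual
identification `𝔤/𝔥 ≅ T_ē(G/H)`. -/
def projTangent {E : Type*} [NormedAddCommGroup E] [NormedSpace ℝ E]
    {F : Type*} [NormedAddCommGroup F] [NormedSpace ℝ F]
    {G : Type*} [TopologicalSpace G] [ChartedSpace E G] [Group G] (H : Subgroup G)
    [ChartedSpace F (G ⧸ H)] :
    GroupLieAlgebra 𝓘(ℝ, E) G →ₗ[ℝ] TangentSpace 𝓘(ℝ, F) ((1 : G) : G ⧸ H) :=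
  (mfderiv 𝓘(ℝ, E) 𝓘(ℝ, F) (fun g : G => (g : G ⧸ H)) 1).toLinearMap

end Lie

end HomPoisson

end

noncomputable section

namespace HomPoisson

open scoped Topology
open Filter VectorField

/-! ### Derivatives of functions along a Lie bracket of vector fields -/

section Calculus

variable {E : Type*} [NormedAddCommGroup E] [NormedSpace ℝ E]
  {M : Type*} [TopologicalSpace M] [ChartedSpace E M]

/-! A `G`-invariant tensor is determined by its value `r` at the base point, and `r` extends to an
invariant field exactly when it is invariant under the isotropy action of `H`. The proof reduces the
Poisson condition to one algebraic equation on `r`, then solves that equation by linear algebra.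

The equation (`IsYangBaxter`) is `ξ(q[Y,Z]) + η(q[Z,X]) + ζ(q[X,Y]) = 0` whenever `X, Y, Z ∈ 𝔤` lift
`ξ^#, η^#, ζ^#`. To obtain it, functions on `G/H` are pulled back to `G`, where the bracket becomes
`-∑ (Y_j f)(X_j g)` with left-invariant fields `X_j, Y_j` (`exists_frame`,
`fnBracket_eventuallyEq`). Then `{{f,g},h}` at the base point is `ZYf - ZXg`, and in the cyclic sum
the second derivatives combine into Lie brackets (`jacobiator_eq`). Hence the Schouten bracket at
the base point is `-2` times the left side of the equation, and invariance carries this to every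
point.

Isotropy invariance need not be imposed separately. Taking `ξ = 0` and `X ∈ 𝔥` in the equation gives
infinitesimal invariance under `𝔥`, which integrates along curves in `H` and spreads to all of `H`
by connectedness (`tensor_translDiff_eq`).

On the algebraic side, `ω(x,y) = β(q x)` when `y` lifts `β^#`, so the equation is the cocycle
identity read through lifts. The case `ζ ∈ Ker r_#` with lift `0` says that `q⁻¹(Im r_#)` is closed
under the bracket. Conversely `ω` induces a nondegenerate form on `𝔞/𝔥`, whose inverse is `r`
(`exists_pair`, `exists_tensor_of_pair`). -/

theorem mvfderiv_congr {f g : M → ℝ} {x : M} (h : f =ᶠ[𝓝 x] g) :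
    mvfderiv 𝓘(ℝ, E) f x = mvfderiv 𝓘(ℝ, E) g x := by
  ext v
  exact congrArg (fun L : E →L[ℝ] ℝ => L v) (h.mfderiv_eq (I := 𝓘(ℝ, E)) (I' := 𝓘(ℝ, ℝ)))

theorem mvfderiv_eq_fderiv_chart [IsManifold 𝓘(ℝ, E) 1 M] {f : M → ℝ} {x y : M}
    (hy : y ∈ (extChartAt 𝓘(ℝ, E) x).source)
    (hf : MDifferentiableAt 𝓘(ℝ, E) 𝓘(ℝ, ℝ) f y) (v : TangentSpace 𝓘(ℝ, E) y) :
    mvfderiv 𝓘(ℝ, E) f y v =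
      fderiv ℝ (f ∘ (extChartAt 𝓘(ℝ, E) x).symm) (extChartAt 𝓘(ℝ, E) x y)
        (mfderiv 𝓘(ℝ, E) 𝓘(ℝ, E) (extChartAt 𝓘(ℝ, E) x) y v) := by
  set φ := extChartAt 𝓘(ℝ, E) x with hφ
  have hsymm : MDifferentiableAt 𝓘(ℝ, E) 𝓘(ℝ, E) φ.symm (φ y) := by
    have := mdifferentiableWithinAt_extChartAt_symm (I := 𝓘(ℝ, E)) (φ.map_source hy)
    rwa [modelWithCornersSelf_coe, Set.range_id, mdifferentiableWithinAt_univ] at this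
  have hfs : MDifferentiableAt 𝓘(ℝ, E) 𝓘(ℝ, ℝ) (f ∘ φ.symm) (φ y) :=
    MDifferentiableAt.comp_of_eq _ hf hsymm (φ.left_inv hy)
  have hch : MDifferentiableAt 𝓘(ℝ, E) 𝓘(ℝ, E) φ y :=
    mdifferentiableAt_extChartAt (by rwa [← extChartAt_source 𝓘(ℝ, E)])
  have hcongr : f =ᶠ[𝓝 y] (f ∘ φ.symm) ∘ φ := by
    filter_upwards [(isOpen_extChartAt_source (I := 𝓘(ℝ, E)) x).mem_nhds hy] with z hz
    simp [φ.left_inv hz]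
  rw [mvfderiv_congr hcongr, mvfderiv_comp_apply y hfs hch, ← mfderiv_eq_fderiv]
  rfl

/-- The manifold bracket is by definition transported from the preferred chart, so the identity
reduces to `fderiv_apply_lieBracket` in the model space, that is, to symmetry of the second
derivative. -/
theorem mvfderiv_apply_mlieBracket [CompleteSpace E] [IsManifold 𝓘(ℝ, E) 2 M]
    {f : M → ℝ} {x : M} (hf : ContMDiffAt 𝓘(ℝ, E) 𝓘(ℝ, ℝ) 2 f x)
    {V W : (y : M) → TangentSpace 𝓘(ℝ, E) y}
    (hV : MDifferentiableAt 𝓘(ℝ, E) 𝓘(ℝ, E).tangent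
      (fun y => (⟨y, V y⟩ : TangentBundle 𝓘(ℝ, E) M)) x)
    (hW : MDifferentiableAt 𝓘(ℝ, E) 𝓘(ℝ, E).tangent
      (fun y => (⟨y, W y⟩ : TangentBundle 𝓘(ℝ, E) M)) x) :
    mvfderiv 𝓘(ℝ, E) f x (mlieBracket 𝓘(ℝ, E) V W x) =
      mvfderiv 𝓘(ℝ, E) (fun y => mvfderiv 𝓘(ℝ, E) f y (W y)) x (V x) -
      mvfderiv 𝓘(ℝ, E) (fun y => mvfderiv 𝓘(ℝ, E) f y (V y)) x (W x) := by
  have : IsManifold 𝓘(ℝ, E) 1 M := IsManifold.of_le (n := 2) (by norm_num)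
  set φ := extChartAt 𝓘(ℝ, E) x with hφ
  set fh : E → ℝ := f ∘ φ.symm with hfh
  have hφs : ContMDiffAt 𝓘(ℝ, E) 𝓘(ℝ, E) 2 φ.symm (φ x) := by
    have := contMDiffWithinAt_extChartAt_symm_range (I := 𝓘(ℝ, E)) (n := 2) x
      (mem_extChartAt_target (I := 𝓘(ℝ, E)) x)
    rwa [modelWithCornersSelf_coe, Set.range_id, contMDiffWithinAt_univ] at this
  have hfh2 : ContDiffAt ℝ 2 fh (φ x) := by
    rw [← contMDiffAt_iff_contDiffAt]
    exact ContMDiffAt.comp_of_eq hf hφs (φ.left_inv (mem_extChartAt_source x))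
  have hmd : ∀ᶠ y in 𝓝 x, MDifferentiableAt 𝓘(ℝ, E) 𝓘(ℝ, ℝ) f y := by
    filter_upwards [(contMDiffAt_iff_contMDiffAt_nhds (by simp)).1 hf] with y hy
    exact hy.mdifferentiableAt (by simp)
  -- The chart representative of `U` at `φ y` is `dφ_y (U y)`, for every `y` in the chart domain and
  -- not only for `x`: the functions `y ↦ df(U y)` are differentiated again.
  have hpb : ∀ (U : (y : M) → TangentSpace 𝓘(ℝ, E) y), ∀ y ∈ φ.source,
      mpullbackWithin 𝓘(ℝ, E) 𝓘(ℝ, E) φ.symm U (Set.range 𝓘(ℝ, E)) (φ y) =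
        mfderiv 𝓘(ℝ, E) 𝓘(ℝ, E) φ y (U y) := by
    intro U y hy
    have A : φ.symm (φ y) = y := φ.left_inv hy
    have h1 := mfderivWithin_extChartAt_symm_comp_mfderiv_extChartAt' (I := 𝓘(ℝ, E)) hy
    have h2 := isInvertible_mfderivWithin_extChartAt_symm (I := 𝓘(ℝ, E)) (φ.map_source hy)
    have h3 : (U (φ.symm (φ y)) : E) = U y := congrArg (fun z => (U z : E)) A
    exact (h2.inverse_apply_eq).2 (h3.trans (DFunLike.congr_fun h1 (U y)).symm)
  have hset : φ.symm ⁻¹' Set.univ ∩ Set.range 𝓘(ℝ, E) = Set.univ := by simp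
  have key : ∀ (U : (y : M) → TangentSpace 𝓘(ℝ, E) y),
      MDifferentiableAt 𝓘(ℝ, E) 𝓘(ℝ, E).tangent
        (fun y => (⟨y, U y⟩ : TangentBundle 𝓘(ℝ, E) M)) x →
      let Uh := mpullbackWithin 𝓘(ℝ, E) 𝓘(ℝ, E) φ.symm U (Set.range 𝓘(ℝ, E))
      DifferentiableAt ℝ (fun z : E => (Uh z : E)) (φ x) ∧
      MDifferentiableAt 𝓘(ℝ, E) 𝓘(ℝ, ℝ) (fun y => mvfderiv 𝓘(ℝ, E) f y (U y)) x ∧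
      (fun y => mvfderiv 𝓘(ℝ, E) f y (U y)) ∘ φ.symm =ᶠ[𝓝 (φ x)]
        fun z => fderiv ℝ fh z (Uh z) := by
    intro U hU Uh
    have hUh : DifferentiableAt ℝ (fun z : E => (Uh z : E)) (φ x) := by
      have := MDifferentiableWithinAt.differentiableWithinAt_mpullbackWithin_vectorField
        (I := 𝓘(ℝ, E)) (V := U) (s := Set.univ) (x := x) (mdifferentiableWithinAt_univ.2 hU)
      exact differentiableWithinAt_univ.1 (hset ▸ this)
    have e1 : (fun y => mvfderiv 𝓘(ℝ, E) f y (U y)) =ᶠ[𝓝 x]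
        fun y => fderiv ℝ fh (φ y) (Uh (φ y)) := by
      filter_upwards [hmd, extChartAt_source_mem_nhds (I := 𝓘(ℝ, E)) x] with y hy hys
      rw [mvfderiv_eq_fderiv_chart hys hy]
      exact congrArg _ (hpb U y hys).symm
    have hdf : DifferentiableAt ℝ (fun z => fderiv ℝ fh z (Uh z)) (φ x) :=
      ((hfh2.fderiv_right (m := 1) (by norm_num)).differentiableAt (by simp)).clm_apply hUh
    refine ⟨hUh, ?_, ?_⟩
    · refine MDifferentiableAt.congr_of_eventuallyEq ?_ e1
      exact MDifferentiableAt.comp x hdf.mdifferentiableAt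
        (mdifferentiableAt_extChartAt (mem_chart_source E x))
    · have ht := hφs.continuousAt.eventually
        (by rw [φ.left_inv (mem_extChartAt_source x)]; exact e1)
      filter_upwards [ht, extChartAt_target_mem_nhds (I := 𝓘(ℝ, E)) x] with z hz hzt
      simp only [Function.comp]
      rw [hz, φ.right_inv hzt]
  obtain ⟨hV1, hV2, hV3⟩ := key V hV
  obtain ⟨hW1, hW2, hW3⟩ := key W hW
  have hx := mem_extChartAt_source (I := 𝓘(ℝ, E)) x
  rw [mvfderiv_eq_fderiv_chart hx hV2, mvfderiv_eq_fderiv_chart hx hW2,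
    mvfderiv_eq_fderiv_chart hx hmd.self_of_nhds, hV3.fderiv_eq, hW3.fderiv_eq,
    ← hpb V x hx, ← hpb W x hx]
  rw [← mlieBracketWithin_univ, mlieBracketWithin_apply]
  have := fderiv_apply_lieBracket (𝕜 := ℝ) hfh2 (by simp) hW1 hV1
  refine Eq.trans ?_ this
  have hinv := isInvertible_mfderiv_extChartAt (I := 𝓘(ℝ, E)) hx
  refine congrArg (fderiv ℝ fh (φ x)) ((hinv.self_apply_inverse _).trans ?_)
  exact (congrArg (fun s => lieBracketWithin ℝ
    (mpullbackWithin 𝓘(ℝ, E) 𝓘(ℝ, E) φ.symm V (Set.range 𝓘(ℝ, E)))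
    (mpullbackWithin 𝓘(ℝ, E) 𝓘(ℝ, E) φ.symm W (Set.range 𝓘(ℝ, E))) s (φ x)) hset).trans
    (congrFun lieBracketWithin_univ _)

end Calculus

/-! ### Left-invariant derivatives on the group -/

section LeftDeriv

variable {E : Type*} [NormedAddCommGroup E] [NormedSpace ℝ E]
  {G : Type*} [TopologicalSpace G] [ChartedSpace E G] [Group G]

/-- The derivative of `F` along the left-invariant vector field with value `Y` at the identity. -/
def leftDeriv (F : G → ℝ) (Y : GroupLieAlgebra 𝓘(ℝ, E) G) (a : G) : ℝ :=
  mvfderiv 𝓘(ℝ, E) (fun b => F (a * b)) 1 Y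

variable [LieGroup 𝓘(ℝ, E) ∞ G]

theorem mdifferentiableAt_mul_left (a b : G) :
    MDifferentiableAt 𝓘(ℝ, E) 𝓘(ℝ, E) (fun b : G => a * b) b :=
  (contMDiff_mul_left (I := 𝓘(ℝ, E)) (n := ∞)).mdifferentiableAt (by simp)

theorem leftDeriv_congr {F F' : G → ℝ} {a : G} (h : F =ᶠ[𝓝 a] F')
    (Y : GroupLieAlgebra 𝓘(ℝ, E) G) : leftDeriv F Y a = leftDeriv F' Y a := by
  have ht : Tendsto (fun b : G => a * b) (𝓝 1) (𝓝 a) := by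
    simpa using (contMDiff_mul_left (I := 𝓘(ℝ, E)) (n := ∞) (a := a)).continuous.tendsto 1
  have hc := ht.eventually h
  exact DFunLike.congr_fun (mvfderiv_congr hc) Y

theorem leftDeriv_eq_mvfderiv {F : G → ℝ} {a : G}
    (hF : MDifferentiableAt 𝓘(ℝ, E) 𝓘(ℝ, ℝ) F a) (Y : GroupLieAlgebra 𝓘(ℝ, E) G) :
    leftDeriv F Y a = mvfderiv 𝓘(ℝ, E) F a (mulInvariantVectorField Y a) :=
  mvfderiv_comp_apply_of_eq (1 : G) hF (mdifferentiableAt_mul_left a 1) (mul_one a) Y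

theorem contMDiffAt_leftDeriv {F : G → ℝ} {a : G}
    (hF : ContMDiffAt 𝓘(ℝ, E) 𝓘(ℝ, ℝ) ∞ F a) (Y : GroupLieAlgebra 𝓘(ℝ, E) G) :
    ContMDiffAt 𝓘(ℝ, E) 𝓘(ℝ, ℝ) ∞ (leftDeriv F Y) a := by
  have hF2 : ContMDiffAt (𝓘(ℝ, E).prod 𝓘(ℝ, E)) 𝓘(ℝ, ℝ) ∞
      (Function.uncurry fun a b : G => F (a * b)) (a, (1 : G)) :=
    ContMDiffAt.comp_of_eq hF (contMDiff_mul 𝓘(ℝ, E) ∞).contMDiffAt (mul_one a)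
  have := ContMDiffAt.mfderiv_apply (I := 𝓘(ℝ, E)) (I' := 𝓘(ℝ, ℝ)) (J := 𝓘(ℝ, E)) (J' := 𝓘(ℝ, E))
    (m := ∞) (n := ∞) (x₀ := a) (fun a b : G => F (a * b)) (fun _ => 1) id (fun _ => Y)
    hF2 contMDiffAt_const contMDiffAt_id contMDiffAt_const (by simp)
  refine this.congr_of_eventuallyEq (Eventually.of_forall fun b => ?_)
  have h := inTangentCoordinates_eq (I := 𝓘(ℝ, E)) (I' := 𝓘(ℝ, ℝ))
    (fun _ : G => (1 : G)) (fun b : G => F (b * 1))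
    (fun b => mfderiv 𝓘(ℝ, E) 𝓘(ℝ, ℝ) (fun y => F (b * y)) 1)
    (x₀ := a) (x := b) (mem_chart_source E (1 : G)) (by rw [chartAt_self_eq]; trivial)
  -- `ContMDiffAt.mfderiv_apply` speaks of derivatives in tangent coordinates. Since differentiation
  -- always takes place at the fixed point `1`, the coordinate changes are trivial.
  rw [tangentBundleCore_coordChange_model_space] at h
  refine (Eq.trans (congrArg (fun L : E →L[ℝ] ℝ => L Y) h) ?_).symm
  exact congrArg (fun v : E => mvfderiv 𝓘(ℝ, E) (fun y => F (b * y)) 1 v)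
    ((tangentBundleCore 𝓘(ℝ, E) G).coordChange_self (achart E 1) 1 (mem_chart_source E (1 : G)) Y)

/-- The bracket of `𝔤` is the value at `1` of the bracket of left-invariant fields, and `leftDeriv`
is differentiation along those fields. -/
theorem leftDeriv_lie [CompleteSpace E] {F : G → ℝ}
    (hF : ContMDiffAt 𝓘(ℝ, E) 𝓘(ℝ, ℝ) ∞ F 1) (X Y : GroupLieAlgebra 𝓘(ℝ, E) G) :
    leftDeriv F ⁅X, Y⁆ 1 = leftDeriv (leftDeriv F Y) X 1 - leftDeriv (leftDeriv F X) Y 1 := by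
  have : IsManifold 𝓘(ℝ, E) ∞ G := ContMDiffMul.toIsManifold
  have h2i : (2 : ℕ∞ω) ≤ ∞ := ENat.LEInfty.out
  have : IsManifold 𝓘(ℝ, E) 2 G := IsManifold.of_le h2i
  have hmd : ∀ᶠ y in 𝓝 (1 : G), MDifferentiableAt 𝓘(ℝ, E) 𝓘(ℝ, ℝ) F y := by
    filter_upwards [(contMDiffAt_iff_contMDiffAt_nhds (by simp)).1 (hF.of_le h2i)] with y hy
    exact hy.mdifferentiableAt (by simp)
  have h1 : ∀ V : GroupLieAlgebra 𝓘(ℝ, E) G,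
      mulInvariantVectorField V (1 : G) = V := fun V => by
    have h : (fun b : G => 1 * b) = id := funext one_mul
    exact (congrArg (fun f : G → G => (mfderiv 𝓘(ℝ, E) 𝓘(ℝ, E) f 1 V : E)) h).trans
      (DFunLike.congr_fun (mfderiv_id (I := 𝓘(ℝ, E)) (x := (1 : G))) V)
  have h2 : ∀ V W : GroupLieAlgebra 𝓘(ℝ, E) G, leftDeriv (leftDeriv F W) V 1 =
      mvfderiv 𝓘(ℝ, E) (fun y => mvfderiv 𝓘(ℝ, E) F y (mulInvariantVectorField W y)) 1
        (mulInvariantVectorField V 1) := by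
    intro V W
    rw [leftDeriv_eq_mvfderiv ((contMDiffAt_leftDeriv hF W).mdifferentiableAt (by simp))]
    refine DFunLike.congr_fun (mvfderiv_congr ?_) _
    filter_upwards [hmd] with y hy using leftDeriv_eq_mvfderiv hy W
  rw [h2, h2, ← mvfderiv_apply_mlieBracket (hF.of_le h2i)
    (mdifferentiableAt_mulInvariantVectorField X) (mdifferentiableAt_mulInvariantVectorField Y),
    leftDeriv_eq_mvfderiv hmd.self_of_nhds, h1, GroupLieAlgebra.bracket_def]

theorem hasDerivAt_comp_mul_curve {F : G → ℝ} {a : G}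
    (hF : MDifferentiableAt 𝓘(ℝ, E) 𝓘(ℝ, ℝ) F a) {c : ℝ → G} (hc0 : c 0 = 1)
    {X : GroupLieAlgebra 𝓘(ℝ, E) G}
    (hc : HasMFDerivAt 𝓘(ℝ, ℝ) 𝓘(ℝ, E) c 0 ((1 : ℝ →L[ℝ] ℝ).smulRight X)) :
    HasDerivAt (fun s => F (a * c s)) (leftDeriv F X a) 0 := by
  have hFa : MDifferentiableAt 𝓘(ℝ, E) 𝓘(ℝ, ℝ) (fun b => F (a * b)) (c 0) := by
    refine MDifferentiableAt.comp_of_eq (y := a) _ hF (mdifferentiableAt_mul_left a _) (by simp [hc0])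
  have h : HasFDerivAt (fun s => F (a * c s)) ((show E →L[ℝ] ℝ from
      mvfderiv 𝓘(ℝ, E) (fun b => F (a * b)) (c 0)).comp
        ((1 : ℝ →L[ℝ] ℝ).smulRight (show E from X))) 0 :=
    (hFa.hasMFDerivAt.comp 0 hc).hasFDerivAt
  refine h.hasDerivAt.congr_deriv ?_
  rw [hc0]
  exact congrArg (show E →L[ℝ] ℝ from mvfderiv 𝓘(ℝ, E) (fun b => F (a * b)) 1)
    (one_smul ℝ (show E from X))

end LeftDeriv

/-! ### Local sections and fibre curves of submersions -/

section Submersion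

variable {E : Type*} [NormedAddCommGroup E] [NormedSpace ℝ E]
  {F : Type*} [NormedAddCommGroup F] [NormedSpace ℝ F]
  {M : Type*} [TopologicalSpace M] [ChartedSpace E M]
  {N : Type*} [TopologicalSpace N] [ChartedSpace F N]
  {f : M → N} {x : M}

theorem submersion_chart_eq (h : Manifold.IsSubmersionAt 𝓘(ℝ, E) 𝓘(ℝ, F) ∞ f x) {z : E}
    (hz : z ∈ h.domChart.target) : h.codChart (f (h.domChart.symm z)) = (h.equiv z).1 := by
  have := h.writtenInCharts (show z ∈ (h.domChart.extend 𝓘(ℝ, E)).target by simpa using hz)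
  simpa using this

theorem submersion_chart_apply (h : Manifold.IsSubmersionAt 𝓘(ℝ, E) 𝓘(ℝ, F) ∞ f x) {y : M}
    (hy : y ∈ h.domChart.source) : h.codChart (f y) = (h.equiv (h.domChart y)).1 := by
  rw [← submersion_chart_eq h (h.domChart.map_source hy), h.domChart.left_inv hy]

/-- In submersion charts `f` is a projection `F × C → F`; freezing the `C`-coordinate at its value
at `x` gives the section. -/
theorem exists_local_section (h : Manifold.IsSubmersionAt 𝓘(ℝ, E) 𝓘(ℝ, F) ∞ f x) :
    ∃ σ : N → M, σ (f x) = x ∧ ContMDiffAt 𝓘(ℝ, F) 𝓘(ℝ, E) ∞ σ (f x) ∧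
      ∀ᶠ y in 𝓝 (f x), f (σ y) = y := by
  set φ := h.domChart with hφ
  set ψ := h.codChart with hψ
  set e := h.equiv with he
  have hx : x ∈ φ.source := h.mem_domChart_source
  have hfx : f x ∈ ψ.source := h.mem_codChart_source
  set c := (e (φ x)).2 with hc
  set ζ : N → E := fun y => e.symm (ψ y, c) with hζ
  have hζx : ζ (f x) = φ x := by
    have h1 : ψ (f x) = (e (φ x)).1 := submersion_chart_apply h hx
    simp only [hζ, h1, hc]
    exact e.symm_apply_apply _
  have hζs : ContMDiffAt 𝓘(ℝ, F) 𝓘(ℝ, E) ∞ ζ (f x) := by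
    have h1 : ContMDiffAt 𝓘(ℝ, F) 𝓘(ℝ, F) ∞ ψ (f x) :=
      contMDiffAt_of_mem_maximalAtlas h.codChart_mem_maximalAtlas hfx
    have h2 : ContDiff ℝ ∞ (fun u : F => e.symm (u, c)) := by fun_prop
    exact h2.contMDiff.contMDiffAt.comp (f x) h1
  refine ⟨fun y => φ.symm (ζ y), by simp [hζx, φ.left_inv hx], ?_, ?_⟩
  · refine ContMDiffAt.comp_of_eq (y := φ x) ?_ hζs hζx
    exact contMDiffAt_symm_of_mem_maximalAtlas h.domChart_mem_maximalAtlas (φ.map_source hx)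
  · have h1 : ∀ᶠ y in 𝓝 (f x), ζ y ∈ φ.target := by
      refine hζs.continuousAt.eventually ?_
      rw [hζx]
      exact φ.open_target.mem_nhds (φ.map_source hx)
    filter_upwards [h1, ψ.open_source.mem_nhds hfx] with y hy hys
    refine ψ.injOn (h.source_subset_preimage_source (φ.map_target hy)) hys ?_
    rw [submersion_chart_eq h hy]
    simp [hζ, ← he]

theorem mfderiv_surjective_of_submersion
    (h : Manifold.IsSubmersionAt 𝓘(ℝ, E) 𝓘(ℝ, F) ∞ f x) :
    Function.Surjective (mfderiv 𝓘(ℝ, E) 𝓘(ℝ, F) f x) := by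
  obtain ⟨σ, hσx, hσ, hfσ⟩ := exists_local_section h
  have h1 : MDifferentiableAt 𝓘(ℝ, F) 𝓘(ℝ, E) σ (f x) := hσ.mdifferentiableAt (by simp)
  have h2 : MDifferentiableAt 𝓘(ℝ, E) 𝓘(ℝ, F) f (σ (f x)) := by
    rw [hσx]; exact h.contMDiffAt.mdifferentiableAt (by simp)
  have h3 := h2.hasMFDerivAt.comp (f x) h1.hasMFDerivAt
  have h4 := h3.congr_of_eventuallyEq (f₁ := id) (by filter_upwards [hfσ] with y hy using hy.symm)
  have h5 := hasMFDerivAt_unique h4 (hasMFDerivAt_id _)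
  have h6 : Function.Surjective (fun u : E => (mfderiv 𝓘(ℝ, E) 𝓘(ℝ, F) f (σ (f x)) u : F)) :=
    fun v => ⟨_, DFunLike.congr_fun h5 v⟩
  rw [hσx] at h6
  exact h6

/-- In the submersion chart the fibre through `x` is a piece of an affine subspace, so it contains
short segments in the vertical directions. The reparametrization `s`, bounded by `1`, keeps the
curve in the chart for all real times, as `lieAlgOf` needs. -/
theorem exists_ball_curve (h : Manifold.IsSubmersionAt 𝓘(ℝ, E) 𝓘(ℝ, F) ∞ f x) :
    ∃ ε > 0, ∀ w : E, ‖w‖ < ε → (h.equiv w).1 = 0 → ∀ s : ℝ → ℝ, ContDiff ℝ ∞ s →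
      (∀ t, |s t| ≤ 1) →
      ContMDiff 𝓘(ℝ, ℝ) 𝓘(ℝ, E) ∞ (fun t => h.domChart.symm (h.domChart x + s t • w)) ∧
      ∀ t, f (h.domChart.symm (h.domChart x + s t • w)) = f x := by
  set φ := h.domChart with hφ
  set ψ := h.codChart with hψ
  have hx : x ∈ φ.source := h.mem_domChart_source
  have hfx : f x ∈ ψ.source := h.mem_codChart_source
  obtain ⟨ε, hε, hball⟩ := Metric.isOpen_iff.1 φ.open_target _ (φ.map_source hx)
  refine ⟨ε, hε, fun w hw hw0 s hs hs1 => ?_⟩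
  have hmem : ∀ t, φ x + s t • w ∈ φ.target := fun t => by
    apply hball
    rw [Metric.mem_ball, dist_eq_norm, add_sub_cancel_left, norm_smul, Real.norm_eq_abs]
    calc |s t| * ‖w‖ ≤ 1 * ‖w‖ := by gcongr; exact hs1 t
      _ < ε := by rwa [one_mul]
  refine ⟨fun t => ?_, fun t => ?_⟩
  · have h1 : ContDiff ℝ ∞ (fun t => φ x + s t • w) := by fun_prop
    exact ContMDiffAt.comp t
      (contMDiffAt_symm_of_mem_maximalAtlas h.domChart_mem_maximalAtlas (hmem t))
      h1.contMDiff.contMDiffAt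
  · refine ψ.injOn (h.source_subset_preimage_source (φ.map_target (hmem t))) hfx ?_
    rw [submersion_chart_eq h (hmem t), submersion_chart_apply h hx]
    simp [hw0, ← hφ]

/-- Points of the fibre near `x` are joined to `x` by smooth curves in the fibre. -/
theorem exists_fibre_curve (h : Manifold.IsSubmersionAt 𝓘(ℝ, E) 𝓘(ℝ, F) ∞ f x) :
    ∀ᶠ y in 𝓝 x, f y = f x → ∃ γ : ℝ → M, ContMDiff 𝓘(ℝ, ℝ) 𝓘(ℝ, E) ∞ γ ∧
      (∀ t, f (γ t) = f x) ∧ γ 0 = x ∧ γ 1 = y := by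
  obtain ⟨ε, hε, hcurve⟩ := exists_ball_curve h
  set φ := h.domChart with hφ
  have hx : x ∈ φ.source := h.mem_domChart_source
  have h1 : ∀ᶠ y in 𝓝 x, ‖φ y - φ x‖ < ε := by
    have := (φ.continuousAt hx).eventually (Metric.ball_mem_nhds _ hε)
    filter_upwards [this] with y hy
    simpa [dist_eq_norm] using hy
  filter_upwards [h1, φ.open_source.mem_nhds hx] with y hy hys hfy
  obtain ⟨h2, h3⟩ := hcurve (φ y - φ x) hy
    (by
      rw [map_sub, Prod.fst_sub, ← submersion_chart_apply h hys, ← submersion_chart_apply h hx,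
        hfy, sub_self])
    -- A bounded smooth function with value `0` at `0` and `1` at `1`.
    (fun t => Real.sin (Real.pi / 2 * t)) (by fun_prop) (fun t => Real.abs_sin_le_one _)
  exact ⟨_, h2, h3, by simp [φ.left_inv hx], by simp [φ.left_inv hys]⟩

/-- Vectors tangent to the fibre are velocities of smooth curves in the fibre. -/
theorem exists_fibre_curve_velocity [IsManifold 𝓘(ℝ, E) ∞ M] [IsManifold 𝓘(ℝ, F) ∞ N]
    (h : Manifold.IsSubmersionAt 𝓘(ℝ, E) 𝓘(ℝ, F) ∞ f x)
    {v : TangentSpace 𝓘(ℝ, E) x} (hv : mfderiv 𝓘(ℝ, E) 𝓘(ℝ, F) f x v = 0) :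
    ∃ γ : ℝ → M, ContMDiff 𝓘(ℝ, ℝ) 𝓘(ℝ, E) ∞ γ ∧ (∀ t, f (γ t) = f x) ∧ γ 0 = x ∧
      HasMFDerivAt 𝓘(ℝ, ℝ) 𝓘(ℝ, E) γ 0 ((1 : ℝ →L[ℝ] ℝ).smulRight v) := by
  obtain ⟨ε, hε, hcurve⟩ := exists_ball_curve h
  set φ := h.domChart with hφ
  set ψ := h.codChart with hψ
  have hx : x ∈ φ.source := h.mem_domChart_source
  have hfx : f x ∈ ψ.source := h.mem_codChart_source
  have hφd : MDifferentiableAt 𝓘(ℝ, E) 𝓘(ℝ, E) φ x :=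
    (contMDiffAt_of_mem_maximalAtlas h.domChart_mem_maximalAtlas hx).mdifferentiableAt (by simp)
  have hφsd : MDifferentiableAt 𝓘(ℝ, E) 𝓘(ℝ, E) φ.symm (φ x) :=
    (contMDiffAt_symm_of_mem_maximalAtlas h.domChart_mem_maximalAtlas
      (φ.map_source hx)).mdifferentiableAt (by simp)
  have hψd : MDifferentiableAt 𝓘(ℝ, F) 𝓘(ℝ, F) ψ (f x) :=
    (contMDiffAt_of_mem_maximalAtlas h.codChart_mem_maximalAtlas hfx).mdifferentiableAt (by simp)
  have hfd : MDifferentiableAt 𝓘(ℝ, E) 𝓘(ℝ, F) f x := h.contMDiffAt.mdifferentiableAt (by simp)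
  set w : E := mfderiv 𝓘(ℝ, E) 𝓘(ℝ, E) φ x v with hw
  have hw0 : (h.equiv w).1 = 0 := by
    have h1 : HasMFDerivAt 𝓘(ℝ, E) 𝓘(ℝ, F) (ψ ∘ f) x _ :=
      hψd.hasMFDerivAt.comp x hfd.hasMFDerivAt
    let L : E →L[ℝ] F := (ContinuousLinearMap.fst ℝ F h.complement).comp
      (h.equiv : E →L[ℝ] F × h.complement)
    have h2 : HasMFDerivAt 𝓘(ℝ, E) 𝓘(ℝ, F) (L ∘ φ) x _ :=
      L.hasMFDerivAt.comp x hφd.hasMFDerivAt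
    have h3 : ψ ∘ f =ᶠ[𝓝 x] L ∘ φ := by
      filter_upwards [φ.open_source.mem_nhds hx] with y hy using submersion_chart_apply h hy
    have h4 := hasMFDerivAt_unique (h2.congr_of_eventuallyEq h3) h1
    have h5 := DFunLike.congr_fun h4 v
    have h6 : mfderiv 𝓘(ℝ, F) 𝓘(ℝ, F) ψ (f x) (mfderiv 𝓘(ℝ, E) 𝓘(ℝ, F) f x v) = 0 := by
      rw [hv]; exact map_zero _
    exact h5.trans h6
  have hback : mfderiv 𝓘(ℝ, E) 𝓘(ℝ, E) φ.symm (φ x) w = v := by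
    have h1 := HasMFDerivAt.comp x hφsd.hasMFDerivAt hφd.hasMFDerivAt
    have h2 : φ.symm ∘ φ =ᶠ[𝓝 x] id := by
      filter_upwards [φ.open_source.mem_nhds hx] with y hy using φ.left_inv hy
    have h3 := hasMFDerivAt_unique (h1.congr_of_eventuallyEq h2.symm) (hasMFDerivAt_id x)
    exact DFunLike.congr_fun h3 v
  -- The direction is shrunk by `c` to fit in the ball; the factor `c⁻¹` inside the sine restores
  -- the velocity at time `0`.
  obtain ⟨c, hc, hcw⟩ : ∃ c : ℝ, 0 < c ∧ ‖c • w‖ < ε := by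
    refine ⟨ε / (‖w‖ + 1), by positivity, ?_⟩
    rw [norm_smul, Real.norm_of_nonneg (by positivity), div_mul_eq_mul_div,
      div_lt_iff₀ (by positivity)]
    nlinarith [norm_nonneg w]
  obtain ⟨h2, h3⟩ := hcurve (c • w) hcw (by rw [map_smul, Prod.smul_fst, hw0, smul_zero])
    (fun t => Real.sin (c⁻¹ * t)) (by fun_prop) (fun t => Real.abs_sin_le_one _)
  refine ⟨_, h2, h3, by simp [φ.left_inv hx], ?_⟩
  have h4 : HasFDerivAt (fun t : ℝ => φ x + Real.sin (c⁻¹ * t) • c • w)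
      ((1 : ℝ →L[ℝ] ℝ).smulRight w) 0 := by
    have h5 : HasDerivAt (fun t : ℝ => c⁻¹ * t) c⁻¹ 0 := by
      simpa using (hasDerivAt_id (0 : ℝ)).const_mul c⁻¹
    have h6 := (h5.sin.smul_const (c • w)).const_add (φ x)
    rw [hasDerivAt_iff_hasFDerivAt] at h6
    refine h6.congr_fderiv ?_
    ext
    simp [smul_smul, hc.ne']
  have e0 : φ x + Real.sin (c⁻¹ * 0) • c • w = φ x := by simp
  have hφsd' : MDifferentiableAt 𝓘(ℝ, E) 𝓘(ℝ, E) φ.symm (φ x + Real.sin (c⁻¹ * 0) • c • w) := by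
    rwa [e0]
  have h7 := hφsd'.hasMFDerivAt.comp (0 : ℝ) h4.hasMFDerivAt
  refine HasMFDerivAt.congr_mfderiv h7 ?_
  refine ContinuousLinearMap.ext fun (t : ℝ) => ?_
  have h8 : (mfderiv 𝓘(ℝ, E) 𝓘(ℝ, E) φ.symm (φ x + Real.sin (c⁻¹ * 0) • c • w) w : E) = v :=
    (congrArg (fun z => (mfderiv 𝓘(ℝ, E) 𝓘(ℝ, E) φ.symm z w : E)) e0).trans hback
  refine (map_smul (show E →L[ℝ] E from
    mfderiv 𝓘(ℝ, E) 𝓘(ℝ, E) φ.symm (φ x + Real.sin (c⁻¹ * 0) • c • w)) t w).trans ?_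
  exact congrArg (fun z : E => t • z) h8

end Submersion

/-! ### Functions with a prescribed differential -/

section LinCoord

variable {F : Type*} [NormedAddCommGroup F] [NormedSpace ℝ F] [FiniteDimensional ℝ F]
  {M : Type*} [TopologicalSpace M] [ChartedSpace F M]

theorem contMDiffAt_linCoord [IsManifold 𝓘(ℝ, F) ∞ M] (x : M) (α : Cotangent F x) :
    ContMDiffAt 𝓘(ℝ, F) 𝓘(ℝ, ℝ) ∞ (linCoord x α) x := by
  let L : F →L[ℝ] ℝ := LinearMap.toContinuousLinearMap (show Module.Dual ℝ F from α)
  exact L.contMDiff.contMDiffAt.comp x (contMDiffAt_extChartAt (I := 𝓘(ℝ, F)))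

theorem differential_linCoord [IsManifold 𝓘(ℝ, F) ∞ M] (x : M) (α : Cotangent F x) :
    differential F (linCoord x α) x = α := by
  let L : F →L[ℝ] ℝ := LinearMap.toContinuousLinearMap (show Module.Dual ℝ F from α)
  have h1 := ((contMDiffAt_linCoord x α).mdifferentiableAt (by simp)).mvfderiv
  have h2 : writtenInExtChartAt 𝓘(ℝ, F) 𝓘(ℝ, ℝ) x (linCoord x α) =ᶠ[𝓝 (extChartAt 𝓘(ℝ, F) x x)]
      L := by
    filter_upwards [extChartAt_target_mem_nhds (I := 𝓘(ℝ, F)) x] with z hz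
    exact congrArg L ((extChartAt 𝓘(ℝ, F) x).right_inv hz)
  have h3 : fderivWithin ℝ (writtenInExtChartAt 𝓘(ℝ, F) 𝓘(ℝ, ℝ) x (linCoord x α))
      (Set.range 𝓘(ℝ, F)) (extChartAt 𝓘(ℝ, F) x x) = L := by
    rw [modelWithCornersSelf_coe, Set.range_id, fderivWithin_univ, h2.fderiv_eq, L.fderiv]
  refine LinearMap.ext fun v => ?_
  exact DFunLike.congr_fun (h1.trans h3) v

omit [FiniteDimensional ℝ F] in
theorem differential_congr {f g : M → ℝ} {x : M} (h : f =ᶠ[𝓝 x] g) :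
    differential F f x = differential F g x := by
  rw [differential, mvfderiv_congr h]; rfl

omit [FiniteDimensional ℝ F] in
theorem fnBracket_congr (π : ContraTensorField F M) {f f' g g' : M → ℝ} {x : M}
    (hf : f =ᶠ[𝓝 x] f') (hg : g =ᶠ[𝓝 x] g') : fnBracket π f g x = fnBracket π f' g' x := by
  rw [fnBracket, fnBracket, differential_congr hf, differential_congr hg]

end LinCoord

/-! ### Smoothness, tangent spaces and invariant brackets on `G/H` -/

section Homogeneous

variable {E : Type*} [NormedAddCommGroup E] [NormedSpace ℝ E]
  {F : Type*} [NormedAddCommGroup F] [NormedSpace ℝ F]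
  {G : Type*} [TopologicalSpace G] [ChartedSpace E G] [Group G]
  {H : Subgroup G} [ChartedSpace F (G ⧸ H)]

/-- Smoothness descends from `G` to `G/H`, since near `aH` the map is the composite of its pullback
with a smooth local section. -/
theorem contMDiffAt_of_comp_proj
    (hp : Manifold.IsSubmersion 𝓘(ℝ, E) 𝓘(ℝ, F) ∞ (fun g : G => (g : G ⧸ H)))
    {E' : Type*} [NormedAddCommGroup E'] [NormedSpace ℝ E']
    {N : Type*} [TopologicalSpace N] [ChartedSpace E' N] {u : G ⧸ H → N} {a : G}
    (hu : ContMDiffAt 𝓘(ℝ, E) 𝓘(ℝ, E') ∞ (fun g : G => u g) a) :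
    ContMDiffAt 𝓘(ℝ, F) 𝓘(ℝ, E') ∞ u (a : G ⧸ H) := by
  obtain ⟨σ, hσ, hσs, hpσ⟩ := exists_local_section (hp.isSubmersionAt a)
  have h1 : ContMDiffAt 𝓘(ℝ, F) 𝓘(ℝ, E') ∞ ((fun g : G => u g) ∘ σ) (a : G ⧸ H) :=
    ContMDiffAt.comp_of_eq hu hσs hσ
  refine h1.congr_of_eventuallyEq ?_
  filter_upwards [hpσ] with y hy
  exact congrArg u hy.symm

theorem mdifferentiableAt_proj
    (hp : Manifold.IsSubmersion 𝓘(ℝ, E) 𝓘(ℝ, F) ∞ (fun g : G => (g : G ⧸ H))) (a : G) :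
    MDifferentiableAt 𝓘(ℝ, E) 𝓘(ℝ, F) (fun g : G => (g : G ⧸ H)) a :=
  hp.contMDiff.mdifferentiableAt (by simp)

theorem projTangent_surjective
    (hp : Manifold.IsSubmersion 𝓘(ℝ, E) 𝓘(ℝ, F) ∞ (fun g : G => (g : G ⧸ H))) :
    Function.Surjective (projTangent (E := E) (F := F) H) :=
  mfderiv_surjective_of_submersion (hp.isSubmersionAt 1)

variable [LieGroup 𝓘(ℝ, E) ∞ G]

theorem contMDiff_smul_quotient
    (hp : Manifold.IsSubmersion 𝓘(ℝ, E) 𝓘(ℝ, F) ∞ (fun g : G => (g : G ⧸ H))) (g : G) :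
    ContMDiff 𝓘(ℝ, F) 𝓘(ℝ, F) ∞ (fun y : G ⧸ H => g • y) := by
  intro y
  induction y using QuotientGroup.induction_on with
  | H a =>
    refine contMDiffAt_of_comp_proj hp ?_
    exact (hp.contMDiff.comp (contMDiff_mul_left (I := 𝓘(ℝ, E)) (n := ∞) (a := g))).contMDiffAt

theorem mdifferentiableAt_smul_quotient
    (hp : Manifold.IsSubmersion 𝓘(ℝ, E) 𝓘(ℝ, F) ∞ (fun g : G => (g : G ⧸ H))) (g : G)
    (y : G ⧸ H) : MDifferentiableAt 𝓘(ℝ, F) 𝓘(ℝ, F) (fun y : G ⧸ H => g • y) y :=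
  (contMDiff_smul_quotient hp g).mdifferentiableAt (by simp)

/-- A curve in `H` projects to a constant; conversely the fibre of `p` through `1` is `H`, and
vertical vectors are velocities of curves in the fibre. -/
theorem mem_lieAlgOf_iff [IsManifold 𝓘(ℝ, F) ∞ (G ⧸ H)]
    (hp : Manifold.IsSubmersion 𝓘(ℝ, E) 𝓘(ℝ, F) ∞ (fun g : G => (g : G ⧸ H)))
    (X : GroupLieAlgebra 𝓘(ℝ, E) G) :
    X ∈ lieAlgOf (E := E) H ↔ projTangent (F := F) H X = 0 := by
  have : IsManifold 𝓘(ℝ, E) ∞ G := ContMDiffMul.toIsManifold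
  constructor
  · rintro ⟨γ, hγ, hγH, hγ0, hγX⟩
    have h1 : MDifferentiableAt 𝓘(ℝ, E) 𝓘(ℝ, F) (fun g : G => (g : G ⧸ H)) (γ 0) :=
      mdifferentiableAt_proj hp _
    have h2 := h1.hasMFDerivAt.comp 0 hγX
    have h3 : (fun g : G => (g : G ⧸ H)) ∘ γ = fun _ => ((1 : G) : G ⧸ H) := by
      funext t
      exact QuotientGroup.eq.2 (by simpa using H.inv_mem (hγH t))
    rw [h3] at h2
    have h4 := hasMFDerivAt_unique h2 (hasMFDerivAt_const _ _)
    have h5 : (mfderiv 𝓘(ℝ, E) 𝓘(ℝ, F) (fun g : G => (g : G ⧸ H)) (γ 0)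
        ((1 : ℝ) • (show E from X)) : F) = 0 := DFunLike.congr_fun h4 (1 : ℝ)
    rw [one_smul, hγ0] at h5
    exact h5
  · intro hX
    obtain ⟨γ, hγ, hγf, hγ0, hγX⟩ := exists_fibre_curve_velocity (hp.isSubmersionAt 1) hX
    refine ⟨γ, hγ, fun t => ?_, hγ0, hγX⟩
    have := hγf t
    simpa using QuotientGroup.eq.1 this.symm


/-- The covector `d_ē (f ∘ λ_a)`, i.e. `λ_a^* df` at the base point. -/
def translDiff (F : Type*) [NormedAddCommGroup F] [NormedSpace ℝ F]
    {G : Type*} [TopologicalSpace G] [Group G] {H : Subgroup G} [ChartedSpace F (G ⧸ H)]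
    (f : G ⧸ H → ℝ) (a : G) : Cotangent F ((1 : G) : G ⧸ H) :=
  differential F (fun y => f (a • y)) ((1 : G) : G ⧸ H)

omit [LieGroup 𝓘(ℝ, E) ∞ G] in
theorem translDiff_one (f : G ⧸ H → ℝ) :
    translDiff F f 1 = differential F f ((1 : G) : G ⧸ H) := by
  simp only [translDiff, one_smul]

omit [LieGroup 𝓘(ℝ, E) ∞ G] in
theorem translDiff_translate (f : G ⧸ H → ℝ) (a b : G) :
    translDiff F (fun y => f (a • y)) b = translDiff F f (a * b) := by
  simp only [translDiff, mul_smul]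

theorem pullback_differential
    (hp : Manifold.IsSubmersion 𝓘(ℝ, E) 𝓘(ℝ, F) ∞ (fun g : G => (g : G ⧸ H)))
    {f : G ⧸ H → ℝ} {a : G} {y : G ⧸ H} (hf : MDifferentiableAt 𝓘(ℝ, F) 𝓘(ℝ, ℝ) f (a • y)) :
    pullback (fun y => a • y) y (differential F f (a • y)) =
      differential F (fun y => f (a • y)) y := by
  refine LinearMap.ext fun v => ?_
  exact (mvfderiv_comp_apply y hf (mdifferentiableAt_smul_quotient hp a y) v).symm

/-- A left derivative of a function pulled back from `G/H` sees its direction only modulo `𝔥`. This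
is what allows computing with arbitrary lifts to `𝔤`. -/
theorem leftDeriv_comp_proj
    (hp : Manifold.IsSubmersion 𝓘(ℝ, E) 𝓘(ℝ, F) ∞ (fun g : G => (g : G ⧸ H)))
    {f : G ⧸ H → ℝ} {a : G} (hf : MDifferentiableAt 𝓘(ℝ, F) 𝓘(ℝ, ℝ) f (a : G ⧸ H))
    (Y : GroupLieAlgebra 𝓘(ℝ, E) G) :
    leftDeriv (fun g : G => f g) Y a = translDiff F f a (projTangent H Y) := by
  have h1 : MDifferentiableAt 𝓘(ℝ, F) 𝓘(ℝ, ℝ) (fun y : G ⧸ H => f (a • y)) ((1 : G) : G ⧸ H) :=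
    MDifferentiableAt.comp_of_eq (y := (a : G ⧸ H)) _ hf (mdifferentiableAt_smul_quotient hp a _)
      (congrArg (fun g : G => (g : G ⧸ H)) (mul_one a))
  exact mvfderiv_comp_apply (1 : G) h1 (mdifferentiableAt_proj hp 1) Y

theorem fnBracket_smul
    (hp : Manifold.IsSubmersion 𝓘(ℝ, E) 𝓘(ℝ, F) ∞ (fun g : G => (g : G ⧸ H)))
    {π : ContraTensorField F (G ⧸ H)} (hπ : IsInvariantTensor G π)
    {f g : G ⧸ H → ℝ} {a : G} {y : G ⧸ H}
    (hf : MDifferentiableAt 𝓘(ℝ, F) 𝓘(ℝ, ℝ) f (a • y))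
    (hg : MDifferentiableAt 𝓘(ℝ, F) 𝓘(ℝ, ℝ) g (a • y)) :
    fnBracket π f g (a • y) = fnBracket π (fun y => f (a • y)) (fun y => g (a • y)) y := by
  rw [fnBracket, fnBracket, ← hπ, pullback_differential hp hf, pullback_differential hp hg]

theorem fnBracket_proj
    (hp : Manifold.IsSubmersion 𝓘(ℝ, E) 𝓘(ℝ, F) ∞ (fun g : G => (g : G ⧸ H)))
    {π : ContraTensorField F (G ⧸ H)} (hπ : IsInvariantTensor G π)
    {f g : G ⧸ H → ℝ} {a : G}
    (hf : MDifferentiableAt 𝓘(ℝ, F) 𝓘(ℝ, ℝ) f (a : G ⧸ H))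
    (hg : MDifferentiableAt 𝓘(ℝ, F) 𝓘(ℝ, ℝ) g (a : G ⧸ H)) :
    fnBracket π f g (a : G ⧸ H) =
      π ((1 : G) : G ⧸ H) (translDiff F f a) (translDiff F g a) := by
  have h : a • ((1 : G) : G ⧸ H) = (a : G ⧸ H) :=
    congrArg (fun g : G => (g : G ⧸ H)) (mul_one a)
  have h2 := fnBracket_smul (y := ((1 : G) : G ⧸ H)) hp hπ (h ▸ hf) (h ▸ hg)
  rw [h] at h2
  exact h2

end Homogeneous

/-! ### Linearity and product rule for left derivatives -/

section LeftDerivAlgebra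

variable {E : Type*} [NormedAddCommGroup E] [NormedSpace ℝ E]
  {G : Type*} [TopologicalSpace G] [ChartedSpace E G] [Group G] [LieGroup 𝓘(ℝ, E) ∞ G]

theorem leftDeriv_const_mul {A : G → ℝ} {a : G} (c : ℝ)
    (hA : MDifferentiableAt 𝓘(ℝ, E) 𝓘(ℝ, ℝ) A a) (Z : GroupLieAlgebra 𝓘(ℝ, E) G) :
    leftDeriv (fun b => c * A b) Z a = c * leftDeriv A Z a := by
  have hc : MDifferentiableAt 𝓘(ℝ, E) 𝓘(ℝ, ℝ) (fun _ : G => c) a := mdifferentiableAt_const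
  have h : MDifferentiableAt 𝓘(ℝ, E) 𝓘(ℝ, ℝ) (fun b => c * A b) a := hc.mul hA
  rw [leftDeriv_eq_mvfderiv h, leftDeriv_eq_mvfderiv hA, mvfderiv_fun_mul hc hA, mvfderiv_const]
  simp

theorem leftDeriv_mul {A B : G → ℝ} {a : G}
    (hA : MDifferentiableAt 𝓘(ℝ, E) 𝓘(ℝ, ℝ) A a) (hB : MDifferentiableAt 𝓘(ℝ, E) 𝓘(ℝ, ℝ) B a)
    (Z : GroupLieAlgebra 𝓘(ℝ, E) G) :
    leftDeriv (fun b => A b * B b) Z a = A a * leftDeriv B Z a + B a * leftDeriv A Z a := by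
  have h : MDifferentiableAt 𝓘(ℝ, E) 𝓘(ℝ, ℝ) (fun b => A b * B b) a := hA.mul hB
  rw [leftDeriv_eq_mvfderiv h, leftDeriv_eq_mvfderiv hA, leftDeriv_eq_mvfderiv hB,
    mvfderiv_fun_mul hA hB]
  simp

theorem leftDeriv_sum {ι : Type*} (s : Finset ι) {A : ι → G → ℝ} {a : G}
    (hA : ∀ i, MDifferentiableAt 𝓘(ℝ, E) 𝓘(ℝ, ℝ) (A i) a) (Z : GroupLieAlgebra 𝓘(ℝ, E) G) :
    MDifferentiableAt 𝓘(ℝ, E) 𝓘(ℝ, ℝ) (fun b => ∑ i ∈ s, A i b) a ∧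
      leftDeriv (fun b => ∑ i ∈ s, A i b) Z a = ∑ i ∈ s, leftDeriv (A i) Z a := by
  classical
  induction s using Finset.induction_on with
  | empty =>
    have hc : MDifferentiableAt 𝓘(ℝ, E) 𝓘(ℝ, ℝ) (fun _ : G => (0 : ℝ)) a :=
      mdifferentiableAt_const
    refine ⟨by simpa using hc, ?_⟩
    simp only [Finset.sum_empty]
    rw [leftDeriv_eq_mvfderiv hc, mvfderiv_const]; rfl
  | insert i s hi ih =>
    simp only [Finset.sum_insert hi]
    have hadd : MDifferentiableAt 𝓘(ℝ, E) 𝓘(ℝ, ℝ) (fun b => A i b + ∑ i ∈ s, A i b) a :=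
      (hA i).add ih.1
    refine ⟨hadd, ?_⟩
    rw [← ih.2, leftDeriv_eq_mvfderiv hadd, leftDeriv_eq_mvfderiv (hA i),
      leftDeriv_eq_mvfderiv ih.1, mvfderiv_fun_add (hA i) ih.1]
    rfl

end LeftDerivAlgebra

/-! ### Writing a bivector through lifts to the Lie algebra -/

section Frame

theorem exists_frame {V L : Type*} [AddCommGroup V] [Module ℝ V] [FiniteDimensional ℝ V]
    [AddCommGroup L] [Module ℝ L] {q : L →ₗ[ℝ] V} (hq : Function.Surjective q)
    {r : LinearMap.BilinForm ℝ (Module.Dual ℝ V)} (hr : r.IsAlt) :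
    ∃ (n : ℕ) (X Y : Fin n → L), ∀ α β : Module.Dual ℝ V,
      r α β = -∑ j, α (q (Y j)) * β (q (X j)) := by
  let b := Module.finBasis ℝ V
  choose l hl using hq
  -- `X_j` lifts the basis vector `b_j` and `Y_j` lifts the image under `r_#` of the dual basis
  -- vector; the sign in the formula comes from skew-symmetry of `r`.
  refine ⟨_, fun j => l (b j), fun j => l ((Module.evalEquiv ℝ V).symm (r (b.coord j))),
    fun α β => ?_⟩
  have hβ : β = ∑ j, β (b j) • b.coord j := by
    refine b.ext fun i => ?_
    simp
  conv_lhs => rw [hβ]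
  simp only [hl, map_sum, map_smul, Module.apply_evalEquiv_symm_apply, smul_eq_mul]
  rw [← Finset.sum_neg_distrib]
  refine Finset.sum_congr rfl fun j _ => ?_
  rw [← hr.neg_eq]
  ring

end Frame

/-! ### The Jacobiator of an invariant bracket -/

section Jacobi

variable {E : Type*} [NormedAddCommGroup E] [NormedSpace ℝ E]
  {F : Type*} [NormedAddCommGroup F] [NormedSpace ℝ F] [FiniteDimensional ℝ F]
  {G : Type*} [TopologicalSpace G] [ChartedSpace E G] [Group G] [LieGroup 𝓘(ℝ, E) ∞ G]
  {H : Subgroup G} [ChartedSpace F (G ⧸ H)] [IsManifold 𝓘(ℝ, F) ∞ (G ⧸ H)]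

omit [FiniteDimensional ℝ F] [LieGroup 𝓘(ℝ, E) ∞ G] in
theorem eventually_mdifferentiableAt_proj
    (hp : Manifold.IsSubmersion 𝓘(ℝ, E) 𝓘(ℝ, F) ∞ (fun g : G => (g : G ⧸ H)))
    {f : G ⧸ H → ℝ} {a : G} (hf : ContMDiffAt 𝓘(ℝ, F) 𝓘(ℝ, ℝ) ∞ f (a : G ⧸ H)) :
    ∀ᶠ b : G in 𝓝 a, MDifferentiableAt 𝓘(ℝ, F) 𝓘(ℝ, ℝ) f (b : G ⧸ H) := by
  have : IsManifold 𝓘(ℝ, F) 1 (G ⧸ H) := IsManifold.of_le (n := ∞) ENat.LEInfty.out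
  have h1 := (contMDiffAt_iff_contMDiffAt_nhds (by simp)).1 (hf.of_le (m := 1) ENat.LEInfty.out)
  have h2 := (mdifferentiableAt_proj hp a).continuousAt.eventually h1
  filter_upwards [h2] with b hb using hb.mdifferentiableAt (by simp)

omit [FiniteDimensional ℝ F] [LieGroup 𝓘(ℝ, E) ∞ G] [IsManifold 𝓘(ℝ, F) ∞ (G ⧸ H)] in
theorem contMDiffAt_comp_proj
    (hp : Manifold.IsSubmersion 𝓘(ℝ, E) 𝓘(ℝ, F) ∞ (fun g : G => (g : G ⧸ H)))
    {f : G ⧸ H → ℝ} {a : G} (hf : ContMDiffAt 𝓘(ℝ, F) 𝓘(ℝ, ℝ) ∞ f (a : G ⧸ H)) :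
    ContMDiffAt 𝓘(ℝ, E) 𝓘(ℝ, ℝ) ∞ (fun g : G => f g) a :=
  hf.comp a hp.contMDiff.contMDiffAt

omit [FiniteDimensional ℝ F] in
theorem fnBracket_eventuallyEq
    (hp : Manifold.IsSubmersion 𝓘(ℝ, E) 𝓘(ℝ, F) ∞ (fun g : G => (g : G ⧸ H)))
    {π : ContraTensorField F (G ⧸ H)} (hπ : IsInvariantTensor G π)
    {n : ℕ} {X Y : Fin n → GroupLieAlgebra 𝓘(ℝ, E) G}
    (hXY : ∀ α β, π ((1 : G) : G ⧸ H) α β =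
      -∑ j, α (projTangent H (Y j)) * β (projTangent H (X j)))
    {f g : G ⧸ H → ℝ} {a : G}
    (hf : ContMDiffAt 𝓘(ℝ, F) 𝓘(ℝ, ℝ) ∞ f (a : G ⧸ H))
    (hg : ContMDiffAt 𝓘(ℝ, F) 𝓘(ℝ, ℝ) ∞ g (a : G ⧸ H)) :
    (fun b : G => fnBracket π f g b) =ᶠ[𝓝 a]
      fun b => ∑ j, (-1 * (leftDeriv (fun g : G => f g) (Y j) b *
        leftDeriv (fun b : G => g b) (X j) b)) := by
  filter_upwards [eventually_mdifferentiableAt_proj hp hf,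
    eventually_mdifferentiableAt_proj hp hg] with b hfb hgb
  rw [fnBracket_proj hp hπ hfb hgb, hXY, ← Finset.sum_neg_distrib]
  refine Finset.sum_congr rfl fun j _ => ?_
  rw [leftDeriv_comp_proj hp hfb, leftDeriv_comp_proj hp hgb, neg_one_mul]

theorem contMDiffAt_fnBracket
    (hp : Manifold.IsSubmersion 𝓘(ℝ, E) 𝓘(ℝ, F) ∞ (fun g : G => (g : G ⧸ H)))
    {π : ContraTensorField F (G ⧸ H)} (hπ : IsInvariantTensor G π)
    (halt : (π ((1 : G) : G ⧸ H)).IsAlt) {f g : G ⧸ H → ℝ} {a : G}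
    (hf : ContMDiffAt 𝓘(ℝ, F) 𝓘(ℝ, ℝ) ∞ f (a : G ⧸ H))
    (hg : ContMDiffAt 𝓘(ℝ, F) 𝓘(ℝ, ℝ) ∞ g (a : G ⧸ H)) :
    ContMDiffAt 𝓘(ℝ, F) 𝓘(ℝ, ℝ) ∞ (fnBracket π f g) (a : G ⧸ H) := by
  obtain ⟨n, X, Y, hXY⟩ := exists_frame (projTangent_surjective hp) halt
  refine contMDiffAt_of_comp_proj hp ?_
  refine ContMDiffAt.congr_of_eventuallyEq ?_ (fnBracket_eventuallyEq hp hπ hXY hf hg)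
  refine ContMDiffAt.sum fun j _ => contMDiffAt_const.mul (ContMDiffAt.mul ?_ ?_)
  · exact contMDiffAt_leftDeriv (contMDiffAt_comp_proj hp hf) _
  · exact contMDiffAt_leftDeriv (contMDiffAt_comp_proj hp hg) _

omit [FiniteDimensional ℝ F] in
-- The inner derivative depends on `W` only through `q W` at every point near `a`, so a linear
-- relation modulo `𝔥` survives a second differentiation. The outer direction `Z` has no such
-- freedom.
theorem leftDeriv_leftDeriv_comp_proj
    (hp : Manifold.IsSubmersion 𝓘(ℝ, E) 𝓘(ℝ, F) ∞ (fun g : G => (g : G ⧸ H)))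
    {f : G ⧸ H → ℝ} {a : G} (hf : ContMDiffAt 𝓘(ℝ, F) 𝓘(ℝ, ℝ) ∞ f (a : G ⧸ H))
    {n : ℕ} (c : Fin n → ℝ) (Y : Fin n → GroupLieAlgebra 𝓘(ℝ, E) G)
    {W : GroupLieAlgebra 𝓘(ℝ, E) G}
    (hW : projTangent (F := F) H W = ∑ j, c j • projTangent H (Y j))
    (Z : GroupLieAlgebra 𝓘(ℝ, E) G) :
    leftDeriv (leftDeriv (fun g : G => f g) W) Z a =
      ∑ j, c j * leftDeriv (leftDeriv (fun g : G => f g) (Y j)) Z a := by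
  have h1 : leftDeriv (fun g : G => f g) W =ᶠ[𝓝 a]
      fun b => ∑ j, c j * leftDeriv (fun g : G => f g) (Y j) b := by
    filter_upwards [eventually_mdifferentiableAt_proj hp hf] with b hb
    rw [leftDeriv_comp_proj hp hb, hW, map_sum]
    refine Finset.sum_congr rfl fun j _ => ?_
    rw [leftDeriv_comp_proj hp hb, map_smul, smul_eq_mul]
  have h2 : ∀ j, MDifferentiableAt 𝓘(ℝ, E) 𝓘(ℝ, ℝ) (leftDeriv (fun g : G => f g) (Y j)) a :=
    fun j => (contMDiffAt_leftDeriv (contMDiffAt_comp_proj hp hf) _).mdifferentiableAt (by simp)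
  rw [leftDeriv_congr h1, (leftDeriv_sum Finset.univ
    (A := fun j b => c j * leftDeriv (fun g : G => f g) (Y j) b) (fun j =>
    (mdifferentiableAt_const (c := c j)).mul (h2 j)) Z).2]
  exact Finset.sum_congr rfl fun j _ => leftDeriv_const_mul (c j) (h2 j) Z

/-- Bracketing with `h` at the base point is `-Z`. Applied to `-∑ (Y_j f)(X_j g)`, the product rule
leaves coefficients that reassemble, modulo `𝔥`, the lifts `Y` of `(dg)^#` and `X` of `(df)^#`. -/
theorem fnBracket_fnBracket
    (hp : Manifold.IsSubmersion 𝓘(ℝ, E) 𝓘(ℝ, F) ∞ (fun g : G => (g : G ⧸ H)))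
    {π : ContraTensorField F (G ⧸ H)} (hπ : IsInvariantTensor G π)
    (halt : (π ((1 : G) : G ⧸ H)).IsAlt) {f g h : G ⧸ H → ℝ}
    (hf : ContMDiffAt 𝓘(ℝ, F) 𝓘(ℝ, ℝ) ∞ f ((1 : G) : G ⧸ H))
    (hg : ContMDiffAt 𝓘(ℝ, F) 𝓘(ℝ, ℝ) ∞ g ((1 : G) : G ⧸ H))
    {X Y Z : GroupLieAlgebra 𝓘(ℝ, E) G}
    (hX : projTangent H X = sharp π ((1 : G) : G ⧸ H) (differential F f ((1 : G) : G ⧸ H)))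
    (hY : projTangent H Y = sharp π ((1 : G) : G ⧸ H) (differential F g ((1 : G) : G ⧸ H)))
    (hZ : projTangent H Z = sharp π ((1 : G) : G ⧸ H) (differential F h ((1 : G) : G ⧸ H))) :
    fnBracket π (fnBracket π f g) h ((1 : G) : G ⧸ H) =
      leftDeriv (leftDeriv (fun b : G => f b) Y) Z 1 -
      leftDeriv (leftDeriv (fun b : G => g b) X) Z 1 := by
  obtain ⟨n, X', Y', hXY⟩ := exists_frame (projTangent_surjective hp) halt
  have hu := contMDiffAt_fnBracket hp hπ halt hf hg
  have hfd := hf.mdifferentiableAt (by simp)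
  have hgd := hg.mdifferentiableAt (by simp)
  have h1 : fnBracket π (fnBracket π f g) h ((1 : G) : G ⧸ H) =
      -leftDeriv (fun b : G => fnBracket π f g b) Z 1 := by
    rw [leftDeriv_comp_proj hp (hu.mdifferentiableAt (by simp)), translDiff_one, hZ, apply_sharp,
      halt.neg_eq]
    rfl
  have hX' : projTangent (F := F) H X =
      ∑ j, (-differential F f ((1 : G) : G ⧸ H) (projTangent H (Y' j))) •
        projTangent H (X' j) := by
    rw [hX, ← sub_eq_zero, ← Module.forall_dual_apply_eq_zero_iff ℝ]
    intro β
    simp [apply_sharp, hXY, map_sum]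
  have hY' : projTangent (F := F) H Y =
      ∑ j, (differential F g ((1 : G) : G ⧸ H) (projTangent H (X' j))) •
        projTangent H (Y' j) := by
    rw [hY, ← sub_eq_zero, ← Module.forall_dual_apply_eq_zero_iff ℝ]
    intro β
    rw [map_sub, apply_sharp, ← halt.neg_eq, hXY]
    simp [map_sum, mul_comm]
  have hF' := fun V => (contMDiffAt_leftDeriv (contMDiffAt_comp_proj hp hf) V).mdifferentiableAt
    (by simp)
  have hG' := fun V => (contMDiffAt_leftDeriv (contMDiffAt_comp_proj hp hg) V).mdifferentiableAt
    (by simp)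
  rw [h1, leftDeriv_congr (fnBracket_eventuallyEq hp hπ hXY hf hg),
    (leftDeriv_sum Finset.univ
      (A := fun j b => -1 * (leftDeriv (fun g : G => f g) (Y' j) b *
        leftDeriv (fun b : G => g b) (X' j) b)) (fun j =>
      (mdifferentiableAt_const (c := (-1 : ℝ))).mul ((hF' (Y' j)).mul (hG' (X' j)))) Z).2,
    leftDeriv_leftDeriv_comp_proj hp hf _ _ hY', leftDeriv_leftDeriv_comp_proj hp hg _ _ hX',
    ← Finset.sum_neg_distrib, ← Finset.sum_sub_distrib]
  refine Finset.sum_congr rfl fun j _ => ?_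
  rw [leftDeriv_const_mul (A := fun b => leftDeriv (fun g : G => f g) (Y' j) b *
    leftDeriv (fun b : G => g b) (X' j) b) _ ((hF' (Y' j)).mul (hG' (X' j))), leftDeriv_mul (hF' (Y' j)) (hG' (X' j)),
    leftDeriv_comp_proj hp hfd, leftDeriv_comp_proj hp hgd, translDiff_one, translDiff_one]
  ring

variable [CompleteSpace E]

/-- Each function occurs with two second derivatives in opposite orders, whose difference is a Lie
bracket. The Jacobiator thus depends only on the first differentials at the base point. -/
theorem jacobiator_eq
    (hp : Manifold.IsSubmersion 𝓘(ℝ, E) 𝓘(ℝ, F) ∞ (fun g : G => (g : G ⧸ H)))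
    {π : ContraTensorField F (G ⧸ H)} (hπ : IsInvariantTensor G π)
    (halt : (π ((1 : G) : G ⧸ H)).IsAlt) {f g h : G ⧸ H → ℝ}
    (hf : ContMDiffAt 𝓘(ℝ, F) 𝓘(ℝ, ℝ) ∞ f ((1 : G) : G ⧸ H))
    (hg : ContMDiffAt 𝓘(ℝ, F) 𝓘(ℝ, ℝ) ∞ g ((1 : G) : G ⧸ H))
    (hh : ContMDiffAt 𝓘(ℝ, F) 𝓘(ℝ, ℝ) ∞ h ((1 : G) : G ⧸ H))
    {X Y Z : GroupLieAlgebra 𝓘(ℝ, E) G}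
    (hX : projTangent H X = sharp π ((1 : G) : G ⧸ H) (differential F f ((1 : G) : G ⧸ H)))
    (hY : projTangent H Y = sharp π ((1 : G) : G ⧸ H) (differential F g ((1 : G) : G ⧸ H)))
    (hZ : projTangent H Z = sharp π ((1 : G) : G ⧸ H) (differential F h ((1 : G) : G ⧸ H))) :
    fnBracket π (fnBracket π f g) h ((1 : G) : G ⧸ H)
      + fnBracket π (fnBracket π g h) f ((1 : G) : G ⧸ H)
      + fnBracket π (fnBracket π h f) g ((1 : G) : G ⧸ H) =
    -(differential F f ((1 : G) : G ⧸ H) (projTangent H ⁅Y, Z⁆)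
      + differential F g ((1 : G) : G ⧸ H) (projTangent H ⁅Z, X⁆)
      + differential F h ((1 : G) : G ⧸ H) (projTangent H ⁅X, Y⁆)) := by
  have key : ∀ {f : G ⧸ H → ℝ}, ContMDiffAt 𝓘(ℝ, F) 𝓘(ℝ, ℝ) ∞ f ((1 : G) : G ⧸ H) →
      ∀ A B : GroupLieAlgebra 𝓘(ℝ, E) G,
      differential F f ((1 : G) : G ⧸ H) (projTangent H ⁅A, B⁆) =
        leftDeriv (leftDeriv (fun b : G => f b) B) A 1 -
        leftDeriv (leftDeriv (fun b : G => f b) A) B 1 := by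
    intro f hf A B
    rw [← leftDeriv_lie (contMDiffAt_comp_proj hp hf),
      leftDeriv_comp_proj hp (hf.mdifferentiableAt (by simp)), translDiff_one]
  rw [fnBracket_fnBracket hp hπ halt hf hg hX hY hZ, fnBracket_fnBracket hp hπ halt hg hh hY hZ hX,
    fnBracket_fnBracket hp hπ halt hh hf hZ hX hY, key hf, key hg, key hh]
  ring

end Jacobi

/-! ### Linear algebra: Yang-Baxter tensors and cocycle pairs -/

section LinearPoisson

variable {V L : Type*} [AddCommGroup V] [Module ℝ V] [LieRing L] [LieAlgebra ℝ L]

/-- `X` lifts `ξ^#` along `q : 𝔤 → 𝔤/𝔥`, i.e. `q X = ξ^#` where `⟨β, ξ^#⟩ = r(ξ, β)`. -/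
def IsSharpLift (q : L →ₗ[ℝ] V) (r : LinearMap.BilinForm ℝ (Module.Dual ℝ V))
    (ξ : Module.Dual ℝ V) (X : L) : Prop :=
  ∀ β : Module.Dual ℝ V, β (q X) = r ξ β

/-- The classical Yang-Baxter equation for `r ∈ ∧²(𝔤/𝔥)`, expressed with lifts to `𝔤`. -/
def IsYangBaxter (q : L →ₗ[ℝ] V) (r : LinearMap.BilinForm ℝ (Module.Dual ℝ V)) : Prop :=
  ∀ (ξ η ζ : Module.Dual ℝ V) (X Y Z : L), IsSharpLift q r ξ X → IsSharpLift q r η Y →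
    IsSharpLift q r ζ Z → ξ (q ⁅Y, Z⁆) + η (q ⁅Z, X⁆) + ζ (q ⁅X, Y⁆) = 0

/-- The pair `P` is `(𝔞_r, ω_r)`. -/
def IsPairOf {𝔥 : Set L} (q : L →ₗ[ℝ] V) (r : LinearMap.BilinForm ℝ (Module.Dual ℝ V))
    (P : CocyclePair 𝔥) : Prop :=
  (∀ X : L, X ∈ P.subalg ↔ ∃ ξ, IsSharpLift q r ξ X) ∧
    ∀ (x y : P.subalg) (α β : Module.Dual ℝ V), IsSharpLift q r α (x : L) →
      IsSharpLift q r β (y : L) → P.form x y = r α β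

theorem eq_of_dual {v w : V} (h : ∀ β : Module.Dual ℝ V, β v = β w) : v = w := by
  rw [← sub_eq_zero, ← Module.forall_dual_apply_eq_zero_iff ℝ]
  intro β
  rw [map_sub, h, sub_self]

variable {q : L →ₗ[ℝ] V} {r : LinearMap.BilinForm ℝ (Module.Dual ℝ V)} {𝔥 : Set L}

theorem isSharpLift_zero_iff {X : L} : IsSharpLift q r 0 X ↔ q X = 0 := by
  constructor
  · exact fun h => eq_of_dual fun β => by rw [h β]; simp
  · intro h β
    simp [h]

theorem exists_isSharpLift [FiniteDimensional ℝ V] (hq : Function.Surjective q)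
    (ξ : Module.Dual ℝ V) : ∃ X : L, IsSharpLift q r ξ X := by
  obtain ⟨X, hX⟩ := hq ((Module.evalEquiv ℝ V).symm (r ξ))
  exact ⟨X, fun β => by rw [hX, Module.apply_evalEquiv_symm_apply]⟩

/-- `Im r_#` is the annihilator of `Ker r_#`. -/
theorem exists_isSharpLift_iff [FiniteDimensional ℝ V] (hr : r.IsAlt) {X : L} :
    (∃ ξ, IsSharpLift q r ξ X) ↔ ∀ φ, r φ = 0 → φ (q X) = 0 := by
  constructor
  · rintro ⟨ξ, hξ⟩ φ hφ
    rw [hξ, ← hr.neg_eq, hφ]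
    simp
  · intro h
    let s : Module.Dual ℝ V →ₗ[ℝ] V := (Module.evalEquiv ℝ V).symm.toLinearMap ∘ₗ r
    have hs : ∀ ξ β, β (s ξ) = r ξ β := fun ξ β => Module.apply_evalEquiv_symm_apply ..
    have h1 : q X ∈ LinearMap.range s := by
      rw [← Subspace.forall_mem_dualAnnihilator_apply_eq_zero_iff]
      intro φ hφ
      refine h φ (LinearMap.ext fun β => ?_)
      rw [Submodule.mem_dualAnnihilator] at hφ
      have := hφ (s β) ⟨β, rfl⟩
      rw [hs] at this
      rw [← hr.neg_eq, this]
      simp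
    obtain ⟨ξ, hξ⟩ := h1
    exact ⟨ξ, fun β => by rw [← hξ, hs]⟩

theorem CocyclePair.ext_of_form {P P' : CocyclePair 𝔥} (h : P.subalg = P'.subalg)
    (hf : ∀ (x y : L) (hx : x ∈ P.subalg) (hy : y ∈ P.subalg) (hx' : x ∈ P'.subalg)
      (hy' : y ∈ P'.subalg), P.form ⟨x, hx⟩ ⟨y, hy⟩ = P'.form ⟨x, hx'⟩ ⟨y, hy'⟩) : P = P' := by
  obtain ⟨A, le, form, alt, coc, rad⟩ := P
  obtain ⟨A', le', form', alt', coc', rad'⟩ := P'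
  obtain rfl : A = A' := h
  obtain rfl : form = form' :=
    LinearMap.ext fun x => LinearMap.ext fun y => hf x y x.2 y.2 x.2 y.2
  rfl

theorem IsPairOf.unique {P P' : CocyclePair 𝔥} (h : IsPairOf q r P) (h' : IsPairOf q r P') :
    P = P' := by
  refine CocyclePair.ext_of_form ?_ ?_
  · ext X
    rw [h.1, h'.1]
  · intro x y hx hy hx' hy'
    obtain ⟨α, hα⟩ := (h.1 x).1 hx
    obtain ⟨β, hβ⟩ := (h.1 y).1 hy
    rw [h.2 ⟨x, hx⟩ ⟨y, hy⟩ α β hα hβ, h'.2 ⟨x, hx'⟩ ⟨y, hy'⟩ α β hα hβ]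

/-- If `X` lifts `α^#`, then `ω(y, X) = α(q y)`, with no reference to `r`. Lifts of `α^#` for two
tensors therefore differ by an element of `Rad(ω) = 𝔥`. -/
theorem IsPairOf.tensor_unique [FiniteDimensional ℝ V] {r' : LinearMap.BilinForm ℝ (Module.Dual ℝ V)}
    (hq : Function.Surjective q) (h𝔥 : ∀ X, X ∈ 𝔥 ↔ q X = 0)
    {P : CocyclePair 𝔥} (h : IsPairOf q r P) (h' : IsPairOf q r' P) : r = r' := by
  refine LinearMap.ext fun α => LinearMap.ext fun β => ?_
  obtain ⟨X, hX⟩ := exists_isSharpLift (r := r) hq α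
  obtain ⟨X', hX'⟩ := exists_isSharpLift (r := r') hq α
  have hXm := (h.1 X).2 ⟨α, hX⟩
  have hXm' := (h'.1 X').2 ⟨α, hX'⟩
  have h1 : X - X' ∈ 𝔥 := by
    refine (P.rad (⟨X, hXm⟩ - ⟨X', hXm'⟩)).1 fun y => ?_
    obtain ⟨η, hη⟩ := (h.1 y).1 y.2
    obtain ⟨η', hη'⟩ := (h'.1 y).1 y.2
    have e1 := h.2 y ⟨X, hXm⟩ η α hη hX
    have e2 := h'.2 y ⟨X', hXm'⟩ η' α hη' hX'
    rw [← hη] at e1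
    rw [← hη'] at e2
    rw [← P.alt.neg_eq, map_sub, e1, e2, sub_self, neg_zero]
  rw [h𝔥, map_sub, sub_eq_zero] at h1
  rw [← hX, ← hX', h1]

theorem exists_pair [FiniteDimensional ℝ V] (hq : Function.Surjective q)
    (h𝔥 : ∀ X, X ∈ 𝔥 ↔ q X = 0) (hr : r.IsAlt) (hyb : IsYangBaxter q r) :
    ∃ P : CocyclePair 𝔥, IsPairOf q r P := by
  let A : LieSubalgebra ℝ L :=
    { carrier := {X | ∃ ξ, IsSharpLift q r ξ X}
      zero_mem' := ⟨0, isSharpLift_zero_iff.2 (map_zero q)⟩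
      add_mem' := by
        rintro X Y ⟨ξ, hξ⟩ ⟨η, hη⟩
        exact ⟨ξ + η, fun β => by rw [map_add, map_add, hξ, hη, map_add, LinearMap.add_apply]⟩
      smul_mem' := by
        rintro c X ⟨ξ, hξ⟩
        exact ⟨c • ξ, fun β => by rw [map_smul, map_smul, hξ, map_smul, LinearMap.smul_apply]⟩
      lie_mem' := by
        rintro X Y ⟨ξ, hξ⟩ ⟨η, hη⟩
        -- Membership is tested against `φ ∈ Ker r_#`: since `φ^#` has lift `0`, two of the three
        -- Yang-Baxter terms vanish and the third is `φ(q[X,Y])`.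
        refine (exists_isSharpLift_iff hr).2 fun φ hφ => ?_
        have h0 : IsSharpLift q r φ 0 := fun β => by simp [hφ]
        simpa using hyb ξ η φ X Y 0 hξ hη h0 }
  have hA : ∀ x : A, ∃ ξ, IsSharpLift q r ξ (x : L) := fun x => x.2
  choose ξ hξ using hA
  have hskew : ∀ x y : A, ξ y (q x) = -ξ x (q y) := fun x y => by
    rw [hξ x, hξ y, hr.neg_eq]
  -- The chosen `ξ` need not be linear; linearity in the second argument follows from `hskew`, which
  -- moves that argument into `q`.
  let Φ : LinearMap.BilinForm ℝ A := LinearMap.mk₂ ℝ (fun x y => ξ y (q x))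
    (fun x x' y => by simp) (fun c x y => by simp)
    (fun x y y' => by rw [hskew, hskew x, hskew x y']; simp; ring)
    (fun c x y => by rw [hskew, hskew x]; simp)
  have hΦ : ∀ (x y : A) (β : Module.Dual ℝ V), IsSharpLift q r β (y : L) →
      Φ x y = β (q x) := fun x y β hβ => by
    change ξ y (q x) = _
    rw [hskew, hβ, hξ x, hr.neg_eq]
  refine ⟨⟨A, ?_, Φ, ?_, ?_, ?_⟩, fun X => Iff.rfl, ?_⟩
  · intro X hX
    exact ⟨0, isSharpLift_zero_iff.2 ((h𝔥 X).1 hX)⟩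
  · intro x
    rw [hΦ x x _ (hξ x), hξ x, hr]
  · intro x y z
    rw [hΦ _ _ _ (hξ z), hΦ _ _ _ (hξ x), hΦ _ _ _ (hξ y)]
    have := hyb _ _ _ _ _ _ (hξ x) (hξ y) (hξ z)
    simp only [LieSubalgebra.coe_bracket]
    linarith
  · intro x
    rw [h𝔥]
    constructor
    · intro h
      refine eq_of_dual fun β => ?_
      obtain ⟨Y, hY⟩ := exists_isSharpLift (r := r) hq β
      rw [← hΦ x ⟨Y, β, hY⟩ β hY, h, map_zero]
    · intro h y
      rw [hΦ x y _ (hξ y), h, map_zero]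
  · intro x y α β hα hβ
    rw [← hα β]
    exact hΦ x y β hβ

/-- The tensor inverts the form: `α^#` is the class modulo `𝔥` of the `x` solving `ω(y, x) = α(q y)`
on `𝔞`. -/
theorem exists_tensor_of_pair [FiniteDimensional ℝ V] [FiniteDimensional ℝ L]
    (h𝔥 : ∀ X, X ∈ 𝔥 ↔ q X = 0) (P : CocyclePair 𝔥) :
    ∃ r : LinearMap.BilinForm ℝ (Module.Dual ℝ V), r.IsAlt ∧ IsYangBaxter q r ∧ IsPairOf q r P := by
  have hex : ∀ α : Module.Dual ℝ V, ∃ x : P.subalg, ∀ y : P.subalg, P.form x y = -α (q y) := by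
    intro α
    let a : Module.Dual ℝ P.subalg := -(α ∘ₗ q ∘ₗ P.subalg.toSubmodule.subtype)
    -- The range of `ω : 𝔞 → 𝔞^*` is the annihilator of its radical `𝔥`, and `α ∘ q` vanishes on
    -- `𝔥`.
    have h1 : a ∈ LinearMap.range P.form := by
      rw [← Subspace.forall_mem_dualAnnihilator_apply_eq_zero_iff]
      intro φ hφ
      obtain ⟨z, rfl⟩ := (Module.evalEquiv ℝ P.subalg).surjective φ
      rw [Submodule.mem_dualAnnihilator] at hφ
      have hz : (z : L) ∈ 𝔥 := (P.rad z).1 fun y => by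
        have : P.form y z = 0 := hφ (P.form y) ⟨y, rfl⟩
        rw [← P.alt.neg_eq, this, neg_zero]
      change -α (q z) = 0
      rw [(h𝔥 _).1 hz, map_zero, neg_zero]
    obtain ⟨x, hx⟩ := h1
    exact ⟨x, fun y => by rw [hx]; rfl⟩
  choose x hx using hex
  have hq_eq : ∀ y z : P.subalg, (∀ w, P.form y w = P.form z w) → q y = q z := by
    intro y z h
    have h1 : ((y - z : P.subalg) : L) ∈ 𝔥 := (P.rad _).1 fun w => by
      rw [map_sub, LinearMap.sub_apply, h, sub_self]
    rw [h𝔥] at h1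
    rw [← sub_eq_zero, ← map_sub]
    exact h1
  -- The solution `x α` is unique only modulo `𝔥`, so it is `q (x α)` that depends linearly on `α`.
  let r : LinearMap.BilinForm ℝ (Module.Dual ℝ V) := LinearMap.mk₂ ℝ (fun α β => β (q (x α)))
    (fun α α' β => by
      rw [← map_add, ← map_add]
      congr 1
      refine hq_eq (x (α + α')) (x α + x α') fun w => ?_
      simp only [map_add, LinearMap.add_apply, hx]; ring)
    (fun c α β => by
      rw [← map_smul, ← map_smul]
      congr 1
      refine hq_eq (x (c • α)) (c • x α) fun w => ?_
      simp only [map_smul, LinearMap.smul_apply, hx, smul_eq_mul]; ring)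
    (fun α β β' => rfl) (fun c α β => rfl)
  have hrx : ∀ α β, r α β = β (q (x α)) := fun α β => rfl
  have hr : r.IsAlt := fun α => by
    rw [hrx, ← neg_neg (α _), ← hx, P.alt, neg_zero]
  have hlift : ∀ {ξ : Module.Dual ℝ V} {X : L}, IsSharpLift q r ξ X → X ∈ P.subalg := by
    intro ξ X h
    have h1 : X - x ξ ∈ 𝔥 := by
      rw [h𝔥, map_sub, sub_eq_zero]
      exact eq_of_dual h
    have h2 := P.subalg.add_mem (P.le h1) (x ξ).2
    rwa [sub_add_cancel] at h2
  have hform : ∀ (w z : P.subalg) (ζ : Module.Dual ℝ V), IsSharpLift q r ζ (z : L) →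
      P.form w z = ζ (q w) := by
    intro w z ζ h
    have h1 : ((z - x ζ : P.subalg) : L) ∈ 𝔥 := by
      rw [h𝔥]
      change q (z - x ζ) = 0
      rw [map_sub, sub_eq_zero]
      exact eq_of_dual h
    have h2 := (P.rad _).2 h1 w
    rw [map_sub, LinearMap.sub_apply, hx, sub_neg_eq_add] at h2
    rw [← P.alt.neg_eq]
    linarith
  refine ⟨r, hr, ?_, ?_, ?_⟩
  · intro ξ η ζ X Y Z hX hY hZ
    have hc := P.cocycle ⟨X, hlift hX⟩ ⟨Y, hlift hY⟩ ⟨Z, hlift hZ⟩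
    rw [hform _ ⟨Z, hlift hZ⟩ ζ hZ, hform _ ⟨X, hlift hX⟩ ξ hX, hform _ ⟨Y, hlift hY⟩ η hY] at hc
    simp only [LieSubalgebra.coe_bracket] at hc
    linarith
  · refine fun Y => ⟨fun hY => (exists_isSharpLift_iff hr).2 fun φ hφ => ?_, fun ⟨ξ, h⟩ => hlift h⟩
    have h1 : ((x φ : P.subalg) : L) ∈ 𝔥 := by
      rw [h𝔥]
      exact eq_of_dual fun β => by rw [← hrx, hφ, map_zero]; rfl
    have h2 := (P.rad _).2 h1 ⟨Y, hY⟩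
    rw [hx] at h2
    exact neg_eq_zero.1 h2
  · intro w z α β hα hβ
    rw [hform w z β hβ, hα]

end LinearPoisson

/-! ### The Poisson condition as the Yang-Baxter equation -/

section YangBaxter

variable {E : Type*} [NormedAddCommGroup E] [NormedSpace ℝ E] [CompleteSpace E]
  {F : Type*} [NormedAddCommGroup F] [NormedSpace ℝ F] [FiniteDimensional ℝ F]
  {G : Type*} [TopologicalSpace G] [ChartedSpace E G] [Group G] [LieGroup 𝓘(ℝ, E) ∞ G]
  {H : Subgroup G} [ChartedSpace F (G ⧸ H)]

omit [CompleteSpace E] [LieGroup 𝓘(ℝ, E) ∞ G] in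
theorem isSharpLift_iff (π : ContraTensorField F (G ⧸ H))
    (ξ : Cotangent F ((1 : G) : G ⧸ H)) (X : GroupLieAlgebra 𝓘(ℝ, E) G) :
    (∀ β : Cotangent F ((1 : G) : G ⧸ H),
      β (projTangent H X) = π ((1 : G) : G ⧸ H) ξ β) ↔
      projTangent H X = sharp π ((1 : G) : G ⧸ H) ξ := by
  constructor
  · intro h
    exact eq_of_dual fun β => by rw [h β, apply_sharp]
  · intro h β
    rw [h, apply_sharp]

variable [IsManifold 𝓘(ℝ, F) ∞ (G ⧸ H)]

theorem isYangBaxter_of_isPoissonTensor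
    (hp : Manifold.IsSubmersion 𝓘(ℝ, E) 𝓘(ℝ, F) ∞ (fun g : G => (g : G ⧸ H)))
    {π : ContraTensorField F (G ⧸ H)} (hπ : IsInvariantTensor G π) (hP : IsPoissonTensor π) :
    IsYangBaxter (projTangent (E := E) H) (π ((1 : G) : G ⧸ H)) := by
  intro ξ η ζ X Y Z hX hY hZ
  have d := differential_linCoord (F := F) ((1 : G) : G ⧸ H)
  have c := contMDiffAt_linCoord (F := F) ((1 : G) : G ⧸ H)
  have h1 := jacobiator_eq hp hπ (hP.alt _) (c ξ) (c η) (c ζ)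
    (X := X) (Y := Y) (Z := Z)
    (by rw [d]; exact (isSharpLift_iff π ξ X).1 hX) (by rw [d]; exact (isSharpLift_iff π η Y).1 hY)
    (by rw [d]; exact (isSharpLift_iff π ζ Z).1 hZ)
  have h2 := hP.schouten _ ξ η ζ
  rw [schoutenSq, h1, d, d, d] at h2
  linarith

theorem isPoissonTensor_of_isYangBaxter
    (hp : Manifold.IsSubmersion 𝓘(ℝ, E) 𝓘(ℝ, F) ∞ (fun g : G => (g : G ⧸ H)))
    {π : ContraTensorField F (G ⧸ H)} (hπ : IsInvariantTensor G π)
    (halt : (π ((1 : G) : G ⧸ H)).IsAlt)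
    (hyb : IsYangBaxter (projTangent (E := E) H) (π ((1 : G) : G ⧸ H))) :
    IsPoissonTensor π := by
  have htrans : ∀ x : G ⧸ H, ∃ a : G, x = a • ((1 : G) : G ⧸ H) := fun x => by
    induction x using QuotientGroup.induction_on with
    | H a => exact ⟨a, congrArg (fun g : G => (g : G ⧸ H)) (mul_one a).symm⟩
  have hbr : ∀ {f g : G ⧸ H → ℝ} {x : G ⧸ H}, ContMDiffAt 𝓘(ℝ, F) 𝓘(ℝ, ℝ) ∞ f x →
      ContMDiffAt 𝓘(ℝ, F) 𝓘(ℝ, ℝ) ∞ g x →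
      ContMDiffAt 𝓘(ℝ, F) 𝓘(ℝ, ℝ) ∞ (fnBracket π f g) x := by
    intro f g x hf hg
    induction x using QuotientGroup.induction_on with
    | H a => exact contMDiffAt_fnBracket hp hπ halt hf hg
  refine ⟨fun x α => ?_, fun U f g hU hf hg x hx => ?_, fun x α β γ => ?_⟩
  · obtain ⟨a, rfl⟩ := htrans x
    rw [← hπ]
    exact halt _
  · exact (hbr (hf.contMDiffAt (hU.mem_nhds hx)) (hg.contMDiffAt (hU.mem_nhds hx))).contMDiffWithinAt
  · obtain ⟨a, rfl⟩ := htrans x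
    have : IsManifold 𝓘(ℝ, F) 1 (G ⧸ H) := IsManifold.of_le (n := ∞) ENat.LEInfty.out
    have hsm : ∀ {f : G ⧸ H → ℝ} {y : G ⧸ H}, ContMDiffAt 𝓘(ℝ, F) 𝓘(ℝ, ℝ) ∞ f (a • y) →
        ContMDiffAt 𝓘(ℝ, F) 𝓘(ℝ, ℝ) ∞ (fun y => f (a • y)) y := fun h =>
      h.comp _ (contMDiff_smul_quotient hp a).contMDiffAt
    have hev : ∀ {f : G ⧸ H → ℝ} {y : G ⧸ H}, ContMDiffAt 𝓘(ℝ, F) 𝓘(ℝ, ℝ) ∞ f (a • y) →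
        ∀ᶠ z : G ⧸ H in 𝓝 y, MDifferentiableAt 𝓘(ℝ, F) 𝓘(ℝ, ℝ) f (a • z) := by
      intro f y hf
      have h1 := (contMDiffAt_iff_contMDiffAt_nhds (by simp)).1
        (hf.of_le (m := 1) ENat.LEInfty.out)
      have h2 := (contMDiff_smul_quotient hp a).continuous.continuousAt.eventually h1
      filter_upwards [h2] with z hz using hz.mdifferentiableAt (by simp)
    -- Invariance moves the double brackets to the base point. The translated coordinate functions
    -- need not be linear in the chart there, hence the need for `jacobiator_eq` with arbitrary
    -- smooth functions.
    have hdd : ∀ {f g h : G ⧸ H → ℝ} {y : G ⧸ H}, ContMDiffAt 𝓘(ℝ, F) 𝓘(ℝ, ℝ) ∞ f (a • y) →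
        ContMDiffAt 𝓘(ℝ, F) 𝓘(ℝ, ℝ) ∞ g (a • y) → ContMDiffAt 𝓘(ℝ, F) 𝓘(ℝ, ℝ) ∞ h (a • y) →
        fnBracket π (fnBracket π f g) h (a • y) =
          fnBracket π (fnBracket π (fun z => f (a • z)) (fun z => g (a • z)))
            (fun z => h (a • z)) y := by
      intro f g h y hf hg hh
      rw [fnBracket_smul hp hπ ((hbr hf hg).mdifferentiableAt (by simp))
        (hh.mdifferentiableAt (by simp))]
      refine fnBracket_congr π ?_ EventuallyEq.rfl
      filter_upwards [hev hf, hev hg] with z hfz hgz using fnBracket_smul hp hπ hfz hgz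
    have c := contMDiffAt_linCoord (F := F) (a • ((1 : G) : G ⧸ H))
    obtain ⟨X, hX⟩ := projTangent_surjective hp (sharp π ((1 : G) : G ⧸ H)
      (differential F (fun z => linCoord _ α (a • z)) ((1 : G) : G ⧸ H)))
    obtain ⟨Y, hY⟩ := projTangent_surjective hp (sharp π ((1 : G) : G ⧸ H)
      (differential F (fun z => linCoord _ β (a • z)) ((1 : G) : G ⧸ H)))
    obtain ⟨Z, hZ⟩ := projTangent_surjective hp (sharp π ((1 : G) : G ⧸ H)
      (differential F (fun z => linCoord _ γ (a • z)) ((1 : G) : G ⧸ H)))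
    have h1 := hyb _ _ _ X Y Z ((isSharpLift_iff π _ X).2 hX) ((isSharpLift_iff π _ Y).2 hY)
      ((isSharpLift_iff π _ Z).2 hZ)
    rw [schoutenSq, hdd (c α) (c β) (c γ), hdd (c β) (c γ) (c α), hdd (c γ) (c α) (c β),
      jacobiator_eq hp hπ halt (hsm (c α)) (hsm (c β)) (hsm (c γ)) hX hY hZ, h1]
    simp

end YangBaxter

/-! ### Isotropy invariance from the Yang-Baxter equation -/

section IsotropyInvariance

theorem proj_eq_one {G : Type*} [Group G] {H : Subgroup G} {h : G} (hh : h ∈ H) : (h : G ⧸ H) = ((1 : G) : G ⧸ H) :=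
  QuotientGroup.eq.2 (by simpa using H.inv_mem hh)

theorem smul_proj_one {G : Type*} [Group G] {H : Subgroup G} {h : G} (hh : h ∈ H) :
    h • ((1 : G) : G ⧸ H) = ((1 : G) : G ⧸ H) :=
  (congrArg (fun g : G => (g : G ⧸ H)) (mul_one h)).trans (proj_eq_one hh)

variable {E : Type*} [NormedAddCommGroup E] [NormedSpace ℝ E] [CompleteSpace E]
  {F : Type*} [NormedAddCommGroup F] [NormedSpace ℝ F] [FiniteDimensional ℝ F]
  {G : Type*} [TopologicalSpace G] [ChartedSpace E G] [Group G] [LieGroup 𝓘(ℝ, E) ∞ G]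
  {H : Subgroup G} [ChartedSpace F (G ⧸ H)] [IsManifold 𝓘(ℝ, F) ∞ (G ⧸ H)]

omit [CompleteSpace E] [FiniteDimensional ℝ F] [IsManifold 𝓘(ℝ, F) ∞ (G ⧸ H)] in
theorem contMDiffAt_comp_smul
    (hp : Manifold.IsSubmersion 𝓘(ℝ, E) 𝓘(ℝ, F) ∞ (fun g : G => (g : G ⧸ H)))
    {f : G ⧸ H → ℝ} (hf : ContMDiffAt 𝓘(ℝ, F) 𝓘(ℝ, ℝ) ∞ f ((1 : G) : G ⧸ H)) {h : G} (hh : h ∈ H) :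
    ContMDiffAt 𝓘(ℝ, F) 𝓘(ℝ, ℝ) ∞ (fun y => f (h • y)) ((1 : G) : G ⧸ H) :=
  ContMDiffAt.comp_of_eq hf (contMDiff_smul_quotient hp h).contMDiffAt (smul_proj_one hh)

omit [FiniteDimensional ℝ F] in
/-- Infinitesimal coadjoint action of `𝔥` on `(𝔤/𝔥)^*`. -/
theorem hasDerivAt_translDiff
    (hp : Manifold.IsSubmersion 𝓘(ℝ, E) 𝓘(ℝ, F) ∞ (fun g : G => (g : G ⧸ H)))
    {f : G ⧸ H → ℝ} (hf : ContMDiffAt 𝓘(ℝ, F) 𝓘(ℝ, ℝ) ∞ f ((1 : G) : G ⧸ H))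
    {c : ℝ → G} (hcH : ∀ t, c t ∈ H) (hc0 : c 0 = 1) {X : GroupLieAlgebra 𝓘(ℝ, E) G}
    (hc : HasMFDerivAt 𝓘(ℝ, ℝ) 𝓘(ℝ, E) c 0 ((1 : ℝ →L[ℝ] ℝ).smulRight X))
    (hX : projTangent (F := F) H X = 0) (Y : GroupLieAlgebra 𝓘(ℝ, E) G) :
    HasDerivAt (fun s => translDiff F f (c s) (projTangent H Y))
      (differential F f ((1 : G) : G ⧸ H) (projTangent H ⁅X, Y⁆)) 0 := by
  have hF := contMDiffAt_comp_proj hp hf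
  have h1 := hasDerivAt_comp_mul_curve (a := 1)
    ((contMDiffAt_leftDeriv hF Y).mdifferentiableAt (by simp)) hc0 hc
  have h2 : ∀ s, leftDeriv (fun g : G => f g) Y (1 * c s) =
      translDiff F f (c s) (projTangent H Y) := fun s => by
    rw [one_mul, leftDeriv_comp_proj hp]
    rw [proj_eq_one (hcH s)]
    exact hf.mdifferentiableAt (by simp)
  simp only [h2] at h1
  refine h1.congr_deriv ?_
  -- The empty sum `n = 0` expresses `q X = 0`: the term `Y(Xf)` vanishes, leaving `[X,Y]f = X(Yf)`.
  have h3 := leftDeriv_leftDeriv_comp_proj hp hf (n := 0) Fin.elim0 Fin.elim0 (W := X)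
    (by simpa using hX) Y
  have h4 := leftDeriv_lie hF X Y
  rw [h3, leftDeriv_comp_proj hp (hf.mdifferentiableAt (by simp)), translDiff_one] at h4
  simp at h4
  exact h4.symm

/-- The derivative is, up to sign, the Yang-Baxter expression with first covector `0`, lifted by `X
∈ 𝔥`. -/
theorem hasDerivAt_tensor_translDiff
    (hp : Manifold.IsSubmersion 𝓘(ℝ, E) 𝓘(ℝ, F) ∞ (fun g : G => (g : G ⧸ H)))
    {r : LinearMap.BilinForm ℝ (Cotangent F ((1 : G) : G ⧸ H))} (hr : r.IsAlt)
    (hyb : IsYangBaxter (projTangent (E := E) H) r)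
    {f g : G ⧸ H → ℝ} (hf : ContMDiffAt 𝓘(ℝ, F) 𝓘(ℝ, ℝ) ∞ f ((1 : G) : G ⧸ H))
    (hg : ContMDiffAt 𝓘(ℝ, F) 𝓘(ℝ, ℝ) ∞ g ((1 : G) : G ⧸ H))
    {c : ℝ → G} (hcH : ∀ t, c t ∈ H) (hc0 : c 0 = 1) {X : GroupLieAlgebra 𝓘(ℝ, E) G}
    (hc : HasMFDerivAt 𝓘(ℝ, ℝ) 𝓘(ℝ, E) c 0 ((1 : ℝ →L[ℝ] ℝ).smulRight X))
    (hX : projTangent (F := F) H X = 0) :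
    HasDerivAt (fun s => r (translDiff F f (c s)) (translDiff F g (c s))) 0 0 := by
  obtain ⟨n, X', Y', hXY⟩ := exists_frame (projTangent_surjective hp) hr
  simp only [hXY]
  set α := differential F f ((1 : G) : G ⧸ H) with hα
  set β := differential F g ((1 : G) : G ⧸ H) with hβ
  have h0f : translDiff F f (c 0) = α := by rw [hc0, translDiff_one]
  have h0g : translDiff F g (c 0) = β := by rw [hc0, translDiff_one]
  have hd := (HasDerivAt.fun_sum (u := Finset.univ) fun j _ =>
    (hasDerivAt_translDiff hp hf hcH hc0 hc hX (Y' j)).mul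
      (hasDerivAt_translDiff hp hg hcH hc0 hc hX (X' j))).neg
  refine hd.congr_deriv ?_
  have hB : IsSharpLift (projTangent H) r β (∑ j, β (projTangent H (X' j)) • Y' j) := by
    intro γ
    rw [← hr.neg_eq, hXY]
    simp [map_sum, mul_comm]
  have hA : IsSharpLift (projTangent H) r α (∑ j, (-α (projTangent H (Y' j))) • X' j) := by
    intro γ
    rw [hXY]
    simp [map_sum]
  have hz := hyb 0 α β X _ _ (isSharpLift_zero_iff.2 hX) hA hB
  rw [LinearMap.zero_apply, zero_add, ← lie_skew _ X] at hz
  simp only [h0f, h0g]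
  simp only [lie_sum, lie_smul, map_neg, map_sum, map_smul,
    smul_eq_mul, neg_mul,
    Finset.sum_neg_distrib] at hz
  rw [Finset.sum_add_distrib]
  simp only [mul_comm (β _)] at hz
  simp only [← hα, ← hβ]
  linarith

theorem tensor_translDiff_const_of_curve
    (hp : Manifold.IsSubmersion 𝓘(ℝ, E) 𝓘(ℝ, F) ∞ (fun g : G => (g : G ⧸ H)))
    {r : LinearMap.BilinForm ℝ (Cotangent F ((1 : G) : G ⧸ H))} (hr : r.IsAlt)
    (hyb : IsYangBaxter (projTangent (E := E) H) r)
    {f g : G ⧸ H → ℝ} (hf : ContMDiffAt 𝓘(ℝ, F) 𝓘(ℝ, ℝ) ∞ f ((1 : G) : G ⧸ H))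
    (hg : ContMDiffAt 𝓘(ℝ, F) 𝓘(ℝ, ℝ) ∞ g ((1 : G) : G ⧸ H))
    {γ : ℝ → G} (hγ : ContMDiff 𝓘(ℝ, ℝ) 𝓘(ℝ, E) ∞ γ) (hγH : ∀ t, γ t ∈ H) (s t : ℝ) :
    r (translDiff F f (γ s)) (translDiff F g (γ s)) =
      r (translDiff F f (γ t)) (translDiff F g (γ t)) := by
  have key : ∀ t, HasDerivAt (fun s => r (translDiff F f (γ s)) (translDiff F g (γ s))) 0 t := by
    intro t
    -- Recentring at `γ t` reduces to time `0`, with `f` and `g` replaced by their translates by `γ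
    -- t`.
    let c : ℝ → G := fun s => (γ t)⁻¹ * γ (t + s)
    have hc : ContMDiff 𝓘(ℝ, ℝ) 𝓘(ℝ, E) ∞ c := by
      have h1 : ContDiff ℝ ∞ (fun s : ℝ => t + s) := by fun_prop
      exact (contMDiff_mul_left (I := 𝓘(ℝ, E)) (n := ∞)).comp (hγ.comp h1.contMDiff)
    have hcH : ∀ s, c s ∈ H := fun s => H.mul_mem (H.inv_mem (hγH t)) (hγH _)
    have hc0 : c 0 = 1 := by simp [c]
    let X : GroupLieAlgebra 𝓘(ℝ, E) G := mfderiv 𝓘(ℝ, ℝ) 𝓘(ℝ, E) c 0 (1 : ℝ)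
    have hcX : HasMFDerivAt 𝓘(ℝ, ℝ) 𝓘(ℝ, E) c 0 ((1 : ℝ →L[ℝ] ℝ).smulRight X) := by
      refine HasMFDerivAt.congr_mfderiv (hc.mdifferentiableAt (by simp)).hasMFDerivAt ?_
      refine ContinuousLinearMap.ext fun (s : ℝ) => ?_
      have := map_smul (show ℝ →L[ℝ] E from mfderiv 𝓘(ℝ, ℝ) 𝓘(ℝ, E) c 0) s 1
      rw [smul_eq_mul, mul_one] at this
      exact this
    have hX : projTangent (F := F) H X = 0 := (mem_lieAlgOf_iff hp X).1 ⟨c, hc, hcH, hc0, hcX⟩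
    have h1 := hasDerivAt_tensor_translDiff hp hr hyb (contMDiffAt_comp_smul hp hf (hγH t))
      (contMDiffAt_comp_smul hp hg (hγH t)) hcH hc0 hcX hX
    simp only [translDiff_translate, c, mul_inv_cancel_left] at h1
    have h2 : HasDerivAt (fun s : ℝ => s - t) 1 t := (hasDerivAt_id t).sub_const t
    have h3 := HasDerivAt.comp_of_eq t h1 h2 (sub_self t).symm
    simpa [Function.comp_def] using h3
  exact is_const_of_deriv_eq_zero (fun t => (key t).differentiableAt) (fun t => (key t).deriv) s t

/-- For connected `H`, the classical Yang-Baxter equation implies `Ad(H)`-invariance. -/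
theorem tensor_translDiff_eq (hconn : IsConnected (H : Set G))
    (hp : Manifold.IsSubmersion 𝓘(ℝ, E) 𝓘(ℝ, F) ∞ (fun g : G => (g : G ⧸ H)))
    {r : LinearMap.BilinForm ℝ (Cotangent F ((1 : G) : G ⧸ H))} (hr : r.IsAlt)
    (hyb : IsYangBaxter (projTangent (E := E) H) r) {h : G} (hh : h ∈ H)
    {f g : G ⧸ H → ℝ} (hf : ContMDiffAt 𝓘(ℝ, F) 𝓘(ℝ, ℝ) ∞ f ((1 : G) : G ⧸ H))
    (hg : ContMDiffAt 𝓘(ℝ, F) 𝓘(ℝ, ℝ) ∞ g ((1 : G) : G ⧸ H)) :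
    r (translDiff F f h) (translDiff F g h) = r (translDiff F f 1) (translDiff F g 1) := by
  -- Quantifying over all `f, g` makes `S` a subgroup, since translates by elements of `H` are again
  -- admissible. It contains a neighbourhood of `1` by fibre curves, so it is open, hence closed,
  -- hence all of the connected `H`.
  let S : Subgroup H :=
    { carrier := {a | ∀ f g : G ⧸ H → ℝ, ContMDiffAt 𝓘(ℝ, F) 𝓘(ℝ, ℝ) ∞ f ((1 : G) : G ⧸ H) →
        ContMDiffAt 𝓘(ℝ, F) 𝓘(ℝ, ℝ) ∞ g ((1 : G) : G ⧸ H) →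
        r (translDiff F f a) (translDiff F g a) = r (translDiff F f 1) (translDiff F g 1)}
      one_mem' := fun f g _ _ => rfl
      mul_mem' := by
        intro a b ha hb f g hf hg
        have h1 := hb _ _ (contMDiffAt_comp_smul hp hf a.2) (contMDiffAt_comp_smul hp hg a.2)
        simp only [translDiff_translate, mul_one] at h1
        exact h1.trans (ha f g hf hg)
      inv_mem' := by
        intro a ha f g hf hg
        have h1 := ha _ _ (contMDiffAt_comp_smul hp hf (H.inv_mem a.2))
          (contMDiffAt_comp_smul hp hg (H.inv_mem a.2))
        simp only [translDiff_translate, mul_one, inv_mul_cancel] at h1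
        exact h1.symm }
  have htg : IsTopologicalGroup G := topologicalGroup_of_lieGroup 𝓘(ℝ, E) ∞
  have hopen : IsOpen (S : Set H) := by
    refine S.isOpen_of_mem_nhds (g := 1) ?_
    have h1 := exists_fibre_curve (hp.isSubmersionAt (1 : G))
    have h2 := ((continuous_subtype_val (p := fun g : G => g ∈ H)).tendsto (1 : H)).eventually h1
    filter_upwards [h2] with a ha f g hf hg
    obtain ⟨γ, hγ, hγ1, hγ0, hγa⟩ := ha (proj_eq_one a.2)
    have hγH : ∀ t, γ t ∈ H := fun t => by simpa using QuotientGroup.eq.1 (hγ1 t).symm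
    have := tensor_translDiff_const_of_curve hp hr hyb hf hg hγ hγH 1 0
    rwa [hγ0, hγa] at this
  have : ConnectedSpace H := isConnected_iff_connectedSpace.1 hconn
  have hmem : (⟨h, hh⟩ : H) ∈ (S : Set H) := by
    rw [IsClopen.eq_univ ⟨S.isClosed_of_isOpen hopen, hopen⟩ ⟨1, S.one_mem⟩]
    trivial
  exact hmem f g hf hg

end IsotropyInvariance

/-! ### Extending the base value to an invariant field -/

section InvariantExtension

variable {E : Type*} [NormedAddCommGroup E] [NormedSpace ℝ E]
  {F : Type*} [NormedAddCommGroup F] [NormedSpace ℝ F]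
  {G : Type*} [TopologicalSpace G] [ChartedSpace E G] [Group G]
  {H : Subgroup G} [ChartedSpace F (G ⧸ H)]

variable (F) in
/-- The pullback of covectors from `ga` to `a`, in the model space. -/
def smulPullback (g : G) (y : G ⧸ H) : Module.Dual ℝ F →ₗ[ℝ] Module.Dual ℝ F :=
  (show F →L[ℝ] F from
    mfderiv 𝓘(ℝ, F) 𝓘(ℝ, F) (fun y : G ⧸ H => g • y) y).toLinearMap.dualMap

/-- The invariant field of contravariant tensors with value `r` at the base point. -/
def invariantTensor (r : LinearMap.BilinForm ℝ (Module.Dual ℝ F)) :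
    ContraTensorField F (G ⧸ H) :=
  fun x => show LinearMap.BilinForm ℝ (Module.Dual ℝ F) from
    r.compl₁₂ (smulPullback F x.out ((1 : G) : G ⧸ H)) (smulPullback F x.out ((1 : G) : G ⧸ H))

theorem invariantTensor_one
    {r : LinearMap.BilinForm ℝ (Module.Dual ℝ F)}
    (hr : ∀ h ∈ H, ∀ α β : Module.Dual ℝ F,
      r (smulPullback F h ((1 : G) : G ⧸ H) α) (smulPullback F h ((1 : G) : G ⧸ H) β) = r α β) :
    invariantTensor (H := H) r ((1 : G) : G ⧸ H) = r := by
  refine LinearMap.ext fun α => LinearMap.ext fun β => ?_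
  refine hr _ ?_ α β
  simpa using QuotientGroup.eq.1 (QuotientGroup.out_eq' ((1 : G) : G ⧸ H)).symm

theorem IsInvariantTensor.ext {π π' : ContraTensorField F (G ⧸ H)} (h : IsInvariantTensor G π)
    (h' : IsInvariantTensor G π') (h1 : π ((1 : G) : G ⧸ H) = π' ((1 : G) : G ⧸ H)) : π = π' := by
  funext x
  induction x using QuotientGroup.induction_on with
  | H a =>
    have hx : a • ((1 : G) : G ⧸ H) = (a : G ⧸ H) :=
      congrArg (fun g : G => (g : G ⧸ H)) (mul_one _)
    rw [← hx]
    refine LinearMap.ext fun α => LinearMap.ext fun β => ?_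
    rw [← h, ← h', h1]

variable [LieGroup 𝓘(ℝ, E) ∞ G]

theorem smulPullback_mul
    (hp : Manifold.IsSubmersion 𝓘(ℝ, E) 𝓘(ℝ, F) ∞ (fun g : G => (g : G ⧸ H))) (a b : G)
    (y : G ⧸ H) (α : Module.Dual ℝ F) :
    smulPullback F (a * b) y α = smulPullback F b y (smulPullback F a (b • y) α) := by
  have h : (fun y : G ⧸ H => (a * b) • y) = (fun y => a • y) ∘ fun y => b • y :=
    funext fun y => mul_smul a b y
  refine LinearMap.ext fun v => ?_
  have h1 := mfderiv_comp_apply y (mdifferentiableAt_smul_quotient hp a (b • y))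
    (mdifferentiableAt_smul_quotient hp b y) v
  rw [← h] at h1
  exact congrArg α h1

/-- Isotropy invariance makes the translated tensor independent of the coset representative, so the
arbitrary choice `x.out` in `invariantTensor` is harmless. -/
theorem tensor_smulPullback_congr
    (hp : Manifold.IsSubmersion 𝓘(ℝ, E) 𝓘(ℝ, F) ∞ (fun g : G => (g : G ⧸ H)))
    {r : LinearMap.BilinForm ℝ (Module.Dual ℝ F)}
    (hr : ∀ h ∈ H, ∀ α β : Module.Dual ℝ F,
      r (smulPullback F h ((1 : G) : G ⧸ H) α) (smulPullback F h ((1 : G) : G ⧸ H) β) = r α β)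
    {a b : G} (hab : (a : G ⧸ H) = (b : G ⧸ H)) (α β : Module.Dual ℝ F) :
    r (smulPullback F a ((1 : G) : G ⧸ H) α) (smulPullback F a ((1 : G) : G ⧸ H) β) =
      r (smulPullback F b ((1 : G) : G ⧸ H) α) (smulPullback F b ((1 : G) : G ⧸ H) β) := by
  obtain ⟨h, hh, rfl⟩ : ∃ h ∈ H, b = a * h :=
    ⟨a⁻¹ * b, QuotientGroup.eq.1 hab, (mul_inv_cancel_left a b).symm⟩
  rw [smulPullback_mul hp a h, smulPullback_mul hp a h, smul_proj_one hh, hr _ hh]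

theorem invariantTensor_isInvariant
    (hp : Manifold.IsSubmersion 𝓘(ℝ, E) 𝓘(ℝ, F) ∞ (fun g : G => (g : G ⧸ H)))
    {r : LinearMap.BilinForm ℝ (Module.Dual ℝ F)}
    (hr : ∀ h ∈ H, ∀ α β : Module.Dual ℝ F,
      r (smulPullback F h ((1 : G) : G ⧸ H) α) (smulPullback F h ((1 : G) : G ⧸ H) β) = r α β) :
    IsInvariantTensor G (invariantTensor (H := H) r) := by
  intro g x α β
  have hout : ((g * x.out : G) : G ⧸ H) = (((g • x).out : G) : G ⧸ H) := by
    rw [QuotientGroup.out_eq']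
    exact congrArg (g • ·) (QuotientGroup.out_eq' x)
  have hx : x.out • ((1 : G) : G ⧸ H) = x :=
    (congrArg (fun g : G => (g : G ⧸ H)) (mul_one _)).trans (QuotientGroup.out_eq' x)
  have key : ∀ α β : Module.Dual ℝ F,
      r (smulPullback F x.out ((1 : G) : G ⧸ H) (smulPullback F g x α))
        (smulPullback F x.out ((1 : G) : G ⧸ H) (smulPullback F g x β)) =
      r (smulPullback F (g • x).out ((1 : G) : G ⧸ H) α)
        (smulPullback F (g • x).out ((1 : G) : G ⧸ H) β) := by
    intro α β
    have h1 := tensor_smulPullback_congr hp hr hout α β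
    rw [smulPullback_mul hp, smulPullback_mul hp, hx] at h1
    exact h1
  exact key α β

variable [FiniteDimensional ℝ F] [IsManifold 𝓘(ℝ, F) ∞ (G ⧸ H)]

theorem translDiff_linCoord
    (hp : Manifold.IsSubmersion 𝓘(ℝ, E) 𝓘(ℝ, F) ∞ (fun g : G => (g : G ⧸ H)))
    (α : Cotangent F ((1 : G) : G ⧸ H)) {h : G} (hh : h ∈ H) :
    translDiff F (linCoord _ α) h = smulPullback F h ((1 : G) : G ⧸ H) α := by
  have h0 := smul_proj_one hh
  have h1 : MDifferentiableAt 𝓘(ℝ, F) 𝓘(ℝ, ℝ) (linCoord _ α) (h • ((1 : G) : G ⧸ H)) := by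
    rw [h0]
    exact (contMDiffAt_linCoord _ α).mdifferentiableAt (by simp)
  -- `h • ē = ē` is only a propositional equality, so the covectors at the two points are compared
  -- in the model space.
  have hc : ∀ y : G ⧸ H, y = ((1 : G) : G ⧸ H) →
      (show Module.Dual ℝ F from differential F (linCoord ((1 : G) : G ⧸ H) α) y) =
        (show Module.Dual ℝ F from α) := by
    rintro _ rfl
    exact differential_linCoord _ α
  have h2 := hc _ h0
  exact (pullback_differential hp h1).symm.trans
    (congrArg (smulPullback F h ((1 : G) : G ⧸ H)) h2)

theorem exists_invariantPoissonTensor [CompleteSpace E] (hconn : IsConnected (H : Set G))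
    (hp : Manifold.IsSubmersion 𝓘(ℝ, E) 𝓘(ℝ, F) ∞ (fun g : G => (g : G ⧸ H)))
    {r : LinearMap.BilinForm ℝ (Cotangent F ((1 : G) : G ⧸ H))} (hr : r.IsAlt)
    (hyb : IsYangBaxter (projTangent (E := E) H) r) :
    ∃ P : InvariantPoissonTensor G F (G ⧸ H), P.tensor ((1 : G) : G ⧸ H) = r := by
  let r' : LinearMap.BilinForm ℝ (Module.Dual ℝ F) := r
  have hinv : ∀ h ∈ H, ∀ α β : Module.Dual ℝ F,
      r' (smulPullback F h ((1 : G) : G ⧸ H) α) (smulPullback F h ((1 : G) : G ⧸ H) β) =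
        r' α β := by
    intro h hh α β
    have h1 := tensor_translDiff_eq hconn hp hr hyb hh
      (contMDiffAt_linCoord _ (show Cotangent F ((1 : G) : G ⧸ H) from α))
      (contMDiffAt_linCoord _ (show Cotangent F ((1 : G) : G ⧸ H) from β))
    rw [translDiff_linCoord hp _ hh, translDiff_linCoord hp _ hh, translDiff_one, translDiff_one,
      differential_linCoord, differential_linCoord] at h1
    exact h1
  have h1 : invariantTensor (H := H) r' ((1 : G) : G ⧸ H) = r := invariantTensor_one hinv
  have hI := invariantTensor_isInvariant hp hinv
  exact ⟨⟨invariantTensor r', isPoissonTensor_of_isYangBaxter hp hI (h1.symm ▸ hr)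
    (h1.symm ▸ hyb), hI⟩, h1⟩

end InvariantExtension

end HomPoisson

end

/-! ### The bijection -/

theorem mainTheorem2
    {E : Type*} [NormedAddCommGroup E] [NormedSpace ℝ E] [FiniteDimensional ℝ E] [CompleteSpace E]
    {F : Type*} [NormedAddCommGroup F] [NormedSpace ℝ F] [FiniteDimensional ℝ F]
    {G : Type*} [TopologicalSpace G] [ChartedSpace E G] [Group G] [LieGroup 𝓘(ℝ, E) ∞ G]
    [ConnectedSpace G]
    (H : Subgroup G) (_hclosed : IsClosed (H : Set G)) (_hconn : IsConnected (H : Set G))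
    -- `G ⧸ H` carries the smooth structure of the quotient manifold: the one for which the
    -- projection `p : G → G ⧸ H` is a smooth submersion
    [ChartedSpace F (G ⧸ H)] [IsManifold 𝓘(ℝ, F) ∞ (G ⧸ H)]
    (_hp : Manifold.IsSubmersion 𝓘(ℝ, E) 𝓘(ℝ, F) ∞ (fun g : G => (g : G ⧸ H))) :
    ∃ Ψ : HomPoisson.InvariantPoissonTensor G F (G ⧸ H) →
        HomPoisson.CocyclePair (HomPoisson.lieAlgOf (E := E) H),
      Function.Bijective Ψ ∧
      ∀ P : HomPoisson.InvariantPoissonTensor G F (G ⧸ H),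
        -- `𝔞 = q⁻¹(Im r_#)`, where `r` is the value of `π` at the base point
        (Ψ P).subalg.toSubmodule =
          (LinearMap.range (HomPoisson.sharp P.tensor ((1 : G) : G ⧸ H))).comap
            (HomPoisson.projTangent H) ∧
        -- `ω(x, y) = r(α, β)` whenever `q(x) = α^#` and `q(y) = β^#`
        ∀ (x y : (Ψ P).subalg) (α β : HomPoisson.Cotangent F ((1 : G) : G ⧸ H)),
          HomPoisson.projTangent H (x : GroupLieAlgebra 𝓘(ℝ, E) G) =
            HomPoisson.sharp P.tensor ((1 : G) : G ⧸ H) α →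
          HomPoisson.projTangent H (y : GroupLieAlgebra 𝓘(ℝ, E) G) =
            HomPoisson.sharp P.tensor ((1 : G) : G ⧸ H) β →
          (Ψ P).form x y = P.tensor ((1 : G) : G ⧸ H) α β := by
  have hq := HomPoisson.projTangent_surjective _hp
  have h𝔥 := HomPoisson.mem_lieAlgOf_iff _hp
  have hex : ∀ P : HomPoisson.InvariantPoissonTensor G F (G ⧸ H),
      ∃ Q : HomPoisson.CocyclePair (HomPoisson.lieAlgOf (E := E) H),
        HomPoisson.IsPairOf (HomPoisson.projTangent H) (P.tensor ((1 : G) : G ⧸ H)) Q := fun P =>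
    HomPoisson.exists_pair hq h𝔥 (P.poisson.alt _)
      (HomPoisson.isYangBaxter_of_isPoissonTensor _hp P.invariant P.poisson)
  choose Ψ hΨ using hex
  refine ⟨Ψ, ⟨fun P P' h => ?_, fun Q => ?_⟩, fun P => ⟨?_, fun x y α β hx hy => ?_⟩⟩
  · have h1 := (hΨ P).tensor_unique hq h𝔥 (h ▸ hΨ P')
    have h2 := P.invariant.ext P'.invariant h1
    cases P
    cases P'
    cases h2
    rfl
  · obtain ⟨r, hr, hyb, hQ⟩ := HomPoisson.exists_tensor_of_pair h𝔥 Q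
    obtain ⟨P, rfl⟩ := HomPoisson.exists_invariantPoissonTensor _hconn _hp hr hyb
    exact ⟨P, (hΨ P).unique hQ⟩
  · ext X
    refine ((hΨ P).1 X).trans ?_
    simp only [Submodule.mem_comap, LinearMap.mem_range]
    exact exists_congr fun ξ => (HomPoisson.isSharpLift_iff P.tensor ξ X).trans eq_comm
  · exact (hΨ P).2 x y α β ((HomPoisson.isSharpLift_iff P.tensor α _).2 hx)
      ((HomPoisson.isSharpLift_iff P.tensor β _).2 hy)
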